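/- On $L^2(\mathbb{R}^2)$ (two bosonic modes, labelled $0$ and $1$, in the Schrödinger representation) let $X_j$ be multiplication by the coordinate $x_j$, $P_j=-i\,\partial/\partial x_j$, $a_j=(X_j+iP_j)/\sqrt2$ and $a_j^\dagger=(X_j-iP_j)/\sqrt2$, all acting on the Schwartz space $\mathcal{S}(\mathbb{R}^2)$. Let $|0,0\rangle$ be the vacuum, with wave function $\pi^{-1/2}e^{-(x_0^2+x_1^2)/2}$, and let $|m,n\rangle=(m!\,n!)^{-1/2}(a_0^\dagger)^m(a_1^\dagger)^n|0,0\rangle$ be the Fock states. The energy of a state $\psi$ is its mean total photon number $\sum_{m,n\ge0}(m+n)\,|\langle m,n|\psi\rangle|^2\in[0,\infty]$, and its mean photon number in mode $1$ is $\sum_{m,n\ge0}n\,|\langle m,n|\psi\rangle|^2$. Let $$H=\tfrac{i}{2}\,X_0^4\,\bigl(a_1^2-a_1^{\dagger 2}\bigr)$$ with domain $\mathcal{S}(\mathbb{R}^2)$. Then $H$ is essentially self-adjoint; its closure therefore generates a unique strongly continuous one-parameter unitary group $(e^{-itH})_{t\in\mathbb{R}}$. For every $t>0$ the state $e^{-itH}|0,0\rangle$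 has infinite energy; in fact its mean photon number in mode $1$ is already infinite. -/

import Mathlib

open MeasureTheory SchwartzMap LineDeriv
open scoped ENNReal LinearPMap

/-! ## Unbounded operators and the unitary groups they generate -/

section UnboundedOperators

variable {E : Type*} [NormedAddCommGroup E] [InnerProductSpace ℂ E] [CompleteSpace E]

/-- A densely defined closable operator is essentially self-adjoint if its closure is
self-adjoint. -/
def IsEssentiallySelfAdjoint (T : E →ₗ.[ℂ] E) : Prop :=
  Dense (T.domain : Set E) ∧ T.IsClosable ∧ IsSelfAdjoint T.closure

/-- `U t = exp (-i t T)`: the family `U` is a strongly continuous one-parameter group of unitary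
operators whose infinitesimal generator is exactly `-i T` (same domain, same values). -/
structure IsUnitaryGroupOf (T : E →ₗ.[ℂ] E) (U : ℝ → E →L[ℂ] E) : Prop where
  unitary : ∀ t, U t ∈ unitary (E →L[ℂ] E)
  zero : U 0 = 1
  add : ∀ s t, U (s + t) = U s * U t
  continuous : ∀ ψ, Continuous fun t => U t ψ
  generator : ∀ ψ φ, (ψ, φ) ∈ T.graph ↔
    HasDerivAt (fun t => U t ψ) (-Complex.I • φ) 0

end UnboundedOperators

noncomputable section

/-! ## Two bosonic modes in the Schrödinger representation -/

/-- The Hilbert space `L²(ℝ²)` of two modes; the first coordinate is the position of mode `0`, the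
second that of mode `1`. -/
abbrev TwoModeSpace : Type := Lp ℂ 2 (volume : Measure (ℝ × ℝ))

/-- The coordinate function `x_j` on `ℝ²`. -/
def coord (j : Fin 2) : ℝ × ℝ →L[ℝ] ℝ :=
  ![ContinuousLinearMap.fst ℝ ℝ ℝ, ContinuousLinearMap.snd ℝ ℝ ℝ] j

/-- The unit vector in the direction of the coordinate `x_j`. -/
def dir (j : Fin 2) : ℝ × ℝ := ![(1, 0), (0, 1)] j

/-- The position operator `X_j`, multiplication by `x_j`, on the Schwartz space. -/
def opX (j : Fin 2) : 𝓢(ℝ × ℝ, ℂ) →L[ℂ] 𝓢(ℝ × ℝ, ℂ) :=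
  smulLeftCLM ℂ fun x => (coord j x : ℂ)

/-- The momentum operator `P_j = -i ∂/∂x_j` on the Schwartz space. -/
def opP (j : Fin 2) : 𝓢(ℝ × ℝ, ℂ) →L[ℂ] 𝓢(ℝ × ℝ, ℂ) :=
  -Complex.I • lineDerivOpCLM ℂ 𝓢(ℝ × ℝ, ℂ) (dir j)

theorem opX_apply (j : Fin 2) (f : 𝓢(ℝ × ℝ, ℂ)) (x : ℝ × ℝ) :
    opX j f x = (coord j x : ℂ) * f x := by
  have h : (fun x : ℝ × ℝ => (coord j x : ℂ)).HasTemperateGrowth :=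
    (Complex.ofRealCLM.comp (coord j)).hasTemperateGrowth
  simp [opX, smulLeftCLM_apply_apply h]

theorem opP_apply (j : Fin 2) (f : 𝓢(ℝ × ℝ, ℂ)) (x : ℝ × ℝ) :
    opP j f x = -Complex.I * lineDeriv ℝ f x (dir j) := by
  simp [opP, SchwartzMap.lineDerivOp_apply]

/-- The annihilation operator `a_j = (X_j + i P_j) / √2` on the Schwartz space. -/
def opA (j : Fin 2) : 𝓢(ℝ × ℝ, ℂ) →L[ℂ] 𝓢(ℝ × ℝ, ℂ) :=
  ((Real.sqrt 2 : ℂ)⁻¹) • (opX j + Complex.I • opP j)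

/-- The creation operator `a_j† = (X_j - i P_j) / √2` on the Schwartz space. -/
def opAdag (j : Fin 2) : 𝓢(ℝ × ℝ, ℂ) →L[ℂ] 𝓢(ℝ × ℝ, ℂ) :=
  ((Real.sqrt 2 : ℂ)⁻¹) • (opX j - Complex.I • opP j)

/-- The embedding of the Schwartz space into `L²(ℝ²)`. -/
def schwartzToL2 : 𝓢(ℝ × ℝ, ℂ) →ₗ[ℂ] TwoModeSpace :=
  (toLpCLM ℂ ℂ 2 (volume : Measure (ℝ × ℝ))).toLinearMap

theorem schwartzToL2_injective : Function.Injective schwartzToL2 :=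
  injective_toLp 2 (volume : Measure (ℝ × ℝ))

/-- An operator on the Schwartz space, seen as an unbounded operator on `L²(ℝ²)` whose domain is
the Schwartz space. -/
def onSchwartz (A : 𝓢(ℝ × ℝ, ℂ) →L[ℂ] 𝓢(ℝ × ℝ, ℂ)) : TwoModeSpace →ₗ.[ℂ] TwoModeSpace where
  domain := LinearMap.range schwartzToL2
  toFun := schwartzToL2 ∘ₗ A.toLinearMap ∘ₗ
    (LinearEquiv.ofInjective schwartzToL2 schwartzToL2_injective).symm.toLinearMap

/-- The Hamiltonian `H = (i/2) X_0⁴ (a_1² - a_1†²)` on the Schwartz space. -/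
def hamiltonian : TwoModeSpace →ₗ.[ℂ] TwoModeSpace :=
  onSchwartz ((Complex.I / 2) • (opX 0 ^ 4 * (opA 1 ^ 2 - opAdag 1 ^ 2)))

/-! ## Vacuum, Fock basis and energy -/

theorem gaussian_contDiff :
    ContDiff ℝ (⊤ : ℕ∞) fun x : ℝ × ℝ => Real.exp (-(x.1 ^ 2 + x.2 ^ 2) / 2) := by
  fun_prop

theorem gaussian_decay (k n : ℕ) : ∃ C : ℝ, ∀ x : ℝ × ℝ,
    ‖x‖ ^ k * ‖iteratedFDeriv ℝ n
      (fun x : ℝ × ℝ => Real.exp (-(x.1 ^ 2 + x.2 ^ 2) / 2)) x‖ ≤ C := by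
  have hf : (fun x : ℝ × ℝ => -(x.1 ^ 2 + x.2 ^ 2) / 2).HasTemperateGrowth := by
    have h1 : (fun x : ℝ × ℝ => x.1).HasTemperateGrowth :=
      (ContinuousLinearMap.fst ℝ ℝ ℝ).hasTemperateGrowth
    have h2 : (fun x : ℝ × ℝ => x.2).HasTemperateGrowth :=
      (ContinuousLinearMap.snd ℝ ℝ ℝ).hasTemperateGrowth
    have h3 : (fun x : ℝ × ℝ => (-1 / 2 : ℝ) * (x.1 * x.1 + x.2 * x.2)).HasTemperateGrowth := by
      fun_prop
    convert h3 using 2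
    ring
  obtain ⟨l, C, hC, hb⟩ := hf.norm_iteratedFDeriv_le_uniform n
  obtain ⟨B, hB⟩ : ∃ B : ℝ, ∀ r : ℝ, 0 ≤ r →
      (1 + r) ^ (k + l * n) * Real.exp (-r ^ 2 / 2) ≤ B := by
    refine ⟨(k + l * n).factorial * Real.exp 2, fun r hr => ?_⟩
    have h1 := Real.pow_div_factorial_le_exp (1 + r) (by linarith) (k + l * n)
    have h2 : (0 : ℝ) < (k + l * n).factorial := by positivity
    rw [div_le_iff₀ h2] at h1
    calc (1 + r) ^ (k + l * n) * Real.exp (-r ^ 2 / 2)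
        ≤ Real.exp (1 + r) * (k + l * n).factorial * Real.exp (-r ^ 2 / 2) := by gcongr
      _ = (k + l * n).factorial * Real.exp (1 + r + -r ^ 2 / 2) := by
          rw [Real.exp_add (1 + r)]; ring
      _ ≤ _ := by
          gcongr
          nlinarith [sq_nonneg (r - 1)]
  refine ⟨n.factorial * (1 + C) ^ n * B, fun x => ?_⟩
  have hexp : ∀ i ≤ n, ‖iteratedFDeriv ℝ i Real.exp (-(x.1 ^ 2 + x.2 ^ 2) / 2)‖ ≤
      Real.exp (-‖x‖ ^ 2 / 2) := by
    intro i _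
    rw [norm_iteratedFDeriv_eq_norm_iteratedDeriv, iteratedDeriv_eq_iterate,
      Real.iter_deriv_exp, Real.norm_eq_abs, abs_of_pos (Real.exp_pos _)]
    refine Real.exp_le_exp.mpr ?_
    rcases max_cases ‖x.1‖ ‖x.2‖ with ⟨h, _⟩ | ⟨h, _⟩ <;>
    · rw [Prod.norm_def, h, Real.norm_eq_abs, sq_abs]
      nlinarith [sq_nonneg x.1, sq_nonneg x.2]
  have hone : (1 : ℝ) ≤ (1 + C) * (1 + ‖x‖) ^ l := by
    have : (1 : ℝ) ≤ (1 + ‖x‖) ^ l := one_le_pow₀ (by linarith [norm_nonneg x])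
    nlinarith
  have hD : ∀ i, 1 ≤ i → i ≤ n →
      ‖iteratedFDeriv ℝ i (fun x : ℝ × ℝ => -(x.1 ^ 2 + x.2 ^ 2) / 2) x‖ ≤
      ((1 + C) * (1 + ‖x‖) ^ l) ^ i := by
    intro i hi hin
    refine (hb i hin x).trans (le_trans ?_ (le_self_pow₀ hone (by omega)))
    gcongr
    linarith
  have key := norm_iteratedFDeriv_comp_le (n := n) (N := ((⊤ : ℕ∞) : WithTop ℕ∞))
    (g := Real.exp) (f := fun x : ℝ × ℝ => -(x.1 ^ 2 + x.2 ^ 2) / 2)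
    Real.contDiff_exp (by fun_prop) (by exact_mod_cast le_top) x hexp hD
  have hx := norm_nonneg x
  calc ‖x‖ ^ k * ‖iteratedFDeriv ℝ n
        (fun x : ℝ × ℝ => Real.exp (-(x.1 ^ 2 + x.2 ^ 2) / 2)) x‖
      ≤ (1 + ‖x‖) ^ k * (n.factorial * Real.exp (-‖x‖ ^ 2 / 2) *
          ((1 + C) * (1 + ‖x‖) ^ l) ^ n) := by
        gcongr
        · linarith
        · exact key
    _ = n.factorial * (1 + C) ^ n * ((1 + ‖x‖) ^ (k + l * n) * Real.exp (-‖x‖ ^ 2 / 2)) := by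
        rw [mul_pow, pow_add, pow_mul]; ring
    _ ≤ _ := by
        gcongr
        exact hB _ hx

/-- The real Gaussian `exp (-(x₀² + x₁²) / 2)` as a Schwartz function. -/
def gaussian : 𝓢(ℝ × ℝ, ℝ) where
  toFun x := Real.exp (-(x.1 ^ 2 + x.2 ^ 2) / 2)
  smooth' := gaussian_contDiff
  decay' := gaussian_decay

/-- The wave function `π^(-1/2) exp (-(x₀² + x₁²) / 2)` of the two-mode vacuum `|0,0⟩`. -/
def vacuum : 𝓢(ℝ × ℝ, ℂ) :=
  ((Real.sqrt Real.pi : ℂ)⁻¹) • postcompCLM (𝕜 := ℝ) Complex.ofRealCLM gaussian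

theorem vacuum_apply (x : ℝ × ℝ) :
    vacuum x = (Real.sqrt Real.pi : ℂ)⁻¹ * (Real.exp (-(x.1 ^ 2 + x.2 ^ 2) / 2) : ℝ) := rfl

/-- The Fock state `|m,n⟩ = (a_0†)^m (a_1†)^n |0,0⟩ / √(m! n!)`. -/
def fock (m n : ℕ) : TwoModeSpace :=
  schwartzToL2 (((Real.sqrt (m.factorial * n.factorial) : ℂ)⁻¹) •
    ((opAdag 0 ^ m * opAdag 1 ^ n) vacuum))

/-- The probability `|⟨m,n|ψ⟩|²` of finding `m` photons in mode `0` and `n` photons in mode `1`. -/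
def photonProb (ψ : TwoModeSpace) (m n : ℕ) : ℝ≥0∞ := ‖inner ℂ (fock m n) ψ‖ₑ ^ 2

/-- The energy of a state: the expectation `⟨N⟩`, in `[0, ∞]`, of the total photon number
`N = N_0 + N_1`. -/
def energy (ψ : TwoModeSpace) : ℝ≥0∞ :=
  ∑' (m : ℕ) (n : ℕ), ((m + n : ℕ) : ℝ≥0∞) * photonProb ψ m n

/-- The expectation `⟨N_1⟩`, in `[0, ∞]`, of the photon number of mode `1`. -/
def energyModeOne (ψ : TwoModeSpace) : ℝ≥0∞ :=
  ∑' (m : ℕ) (n : ℕ), (n : ℝ≥0∞) * photonProb ψ m n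

end

/-! Since `a² - a†² = i (XP + PX)`, the operator `-iH` is `x₀⁴ (x₁ ∂₁ + 1/2)`: a real vector field
plus half its divergence. Its group is therefore explicit, `(U_t f)(x) = e^{t x₀⁴/2} f(x₀, e^{t x₀⁴}
x₁)`, i.e. squeezing of mode 1 by the amount `r = t x₀⁴`. The Schwartz space is not invariant (on
`x₁ = 0` the evolved vacuum grows like `e^{t x₀⁴/2 - x₀²/2}`), but `C_c^∞` is, and there `U_t` is
differentiable with derivative `-iH`. Invariance of a dense domain inside the generator rules out
deficiency vectors, so `H` restricted to `C_c^∞` is essentially self-adjoint; the symmetric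
extension to Schwartz functions then has the same closure
(`IsStrongUnitaryGroup.isEssentiallySelfAdjoint`).

For the energy, the components `|0,2k⟩` suffice. Conditionally on `x₀ = a` the overlap of the
squeezed vacuum with a Hermite function is a Gaussian integral proportional to `tanh(r)^k / √(cosh
r)`. This gives `2k · P(0,2k) ≥ I_k² / π`, where `I_k = ∫ e^{-a²} tanh(t a⁴)^k / √(cosh(t a⁴)) da`
(`le_photonProb`). As `I_k` decreases in `k`, the energy is at least `N I_N² / π` for every `N`.

The factor `tanh^N` is harmless once `e^{2ta⁴}` exceeds a multiple of `N`, that is, for `a` beyond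
some `X` of order `(log N)^{1/4}`. There `1/cosh` costs only about `N^{-1/2}` in `I_N²`, and the
Gaussian only `e^{-O(√(log N))}`, so `N I_N²` is unbounded (`exists_le_mul_overlapIntegral_sq`). The
power 4 matters here: `a²` is negligible against `t a⁴`. -/

/-! ### Unitary groups, their generators and invariant cores -/

section UnitaryGroups

variable {E : Type*} [NormedAddCommGroup E] [InnerProductSpace ℂ E] [CompleteSpace E]

/-- A strongly continuous one-parameter group of unitary operators. -/
structure IsStrongUnitaryGroup (U : ℝ → E →L[ℂ] E) : Prop where
  unitary : ∀ t, U t ∈ unitary (E →L[ℂ] E)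
  zero : U 0 = 1
  add : ∀ s t, U (s + t) = U s * U t
  continuous : ∀ ψ, Continuous fun t => U t ψ

/-- `(ψ, φ)` lies in the graph of the self-adjoint generator of `U`. -/
def InGenerator (U : ℝ → E →L[ℂ] E) (ψ φ : E) : Prop :=
  HasDerivAt (fun t => U t ψ) (-Complex.I • φ) 0

theorem IsUnitaryGroupOf.isStrongUnitaryGroup {T : E →ₗ.[ℂ] E} {U : ℝ → E →L[ℂ] E}
    (h : IsUnitaryGroupOf T U) : IsStrongUnitaryGroup U :=
  ⟨h.unitary, h.zero, h.add, h.continuous⟩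

namespace IsStrongUnitaryGroup

variable {U : ℝ → E →L[ℂ] E} (hU : IsStrongUnitaryGroup U)
include hU

theorem inner_map_map (t : ℝ) (x y : E) : inner ℂ (U t x) (U t y) = inner ℂ x y :=
  ContinuousLinearMap.inner_map_map_of_mem_unitary (hU.unitary t) x y

theorem norm_map (t : ℝ) (x : E) : ‖U t x‖ = ‖x‖ :=
  ContinuousLinearMap.norm_map_of_mem_unitary (hU.unitary t) x

theorem hasDerivAt {ψ φ : E} (h : InGenerator U ψ φ) (t : ℝ) :
    HasDerivAt (fun s => U s ψ) (-Complex.I • U t φ) t := by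
  have h0 : HasDerivAt (fun s => U (s - t) ψ) (-Complex.I • φ) t := by
    have h2 : HasDerivAt (fun s : ℝ => U s ψ) (-Complex.I • φ) (t - t) := by
      rw [sub_self]; exact h
    simpa using h2.comp_sub_const t t
  have h1 := ((U t).restrictScalars ℝ).hasFDerivAt.comp_hasDerivAt t h0
  have h3 : (((U t).restrictScalars ℝ) ∘ fun s => U (s - t) ψ) = fun s => U s ψ := by
    funext s
    have := hU.add t (s - t)
    rw [add_sub_cancel] at this
    simp [this]
  rw [h3] at h1
  simpa using h1

theorem inGenerator_map {ψ φ : E} (h : InGenerator U ψ φ) (t : ℝ) :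
    InGenerator U (U t ψ) (U t φ) := by
  have h1 := hU.hasDerivAt h t
  have h2 : HasDerivAt (fun s => U (s + t) ψ) (-Complex.I • U t φ) 0 := by
    have h1' : HasDerivAt (fun s => U s ψ) (-Complex.I • U t φ) (0 + t) := by rwa [zero_add]
    exact h1'.comp_add_const 0 t
  simpa [InGenerator, hU.add] using h2

theorem inner_eq_of_inGenerator {ψ φ ψ' φ' : E} (h : InGenerator U ψ φ)
    (h' : InGenerator U ψ' φ') : inner ℂ φ ψ' = inner ℂ ψ φ' := by
  have h1 := HasDerivAt.inner ℂ h h'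
  have h2 : (fun t => inner ℂ (U t ψ) (U t ψ')) = fun _ => inner ℂ ψ ψ' := by
    funext t; exact hU.inner_map_map t _ _
  rw [h2] at h1
  have h3 := h1.unique (hasDerivAt_const (0 : ℝ) (inner ℂ ψ ψ'))
  simp only [hU.zero, one_apply_eq_self, inner_smul_left, inner_smul_right,
    map_neg, Complex.conj_I, neg_neg] at h3
  have h4 : Complex.I * (inner ℂ φ ψ' - inner ℂ ψ φ') = 0 := by linear_combination h3
  simpa [sub_eq_zero] using h4

/-- Mean value inequality for `s ↦ U s ψ + s • I • φ`, whose derivative is `-I • (U s φ - φ)`. The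
bound mentions no derivative, which is what lets it pass to limits. -/
theorem norm_sub_le_of_inGenerator {ψ φ : E} (h : InGenerator U ψ φ) {t C : ℝ}
    (hC : ∀ s, |s| ≤ |t| → ‖U s φ - φ‖ ≤ C) :
    ‖U t ψ - ψ + t • Complex.I • φ‖ ≤ C * |t| := by
  have hd : ∀ s ∈ Set.uIcc 0 t, HasDerivWithinAt (fun s => U s ψ + s • Complex.I • φ)
      (-Complex.I • U s φ + (1 : ℝ) • Complex.I • φ) (Set.uIcc 0 t) s := fun s _ =>
    ((hU.hasDerivAt h s).add ((hasDerivAt_id s).smul_const (Complex.I • φ))).hasDerivWithinAt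
  have hb : ∀ s ∈ Set.uIcc 0 t, ‖-Complex.I • U s φ + (1 : ℝ) • Complex.I • φ‖ ≤ C := by
    intro s hs
    have e : -Complex.I • U s φ + (1 : ℝ) • Complex.I • φ = -Complex.I • (U s φ - φ) := by
      rw [one_smul, smul_sub]; simp
    rw [e, norm_smul]
    simp only [norm_neg, Complex.norm_I, one_mul]
    apply hC
    simpa using Set.abs_sub_left_of_mem_uIcc hs
  have := (convex_uIcc (0 : ℝ) t).norm_image_sub_le_of_norm_hasDerivWithin_le hd hb
    Set.left_mem_uIcc Set.right_mem_uIcc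
  simp only [hU.zero, zero_smul, add_zero, one_apply_eq_self, sub_zero,
    Real.norm_eq_abs] at this
  convert this using 2
  abel

/-- Strong continuity at `0` makes `C` arbitrarily small for small `t`, so the inequality of
`norm_sub_le_of_inGenerator` characterises the generator. -/
theorem inGenerator_of_norm_sub_le {ψ φ : E}
    (h : ∀ t C : ℝ, (∀ s, |s| ≤ |t| → ‖U s φ - φ‖ ≤ C) →
      ‖U t ψ - ψ + t • Complex.I • φ‖ ≤ C * |t|) : InGenerator U ψ φ := by
  rw [InGenerator, hasDerivAt_iff_isLittleO_nhds_zero, Asymptotics.isLittleO_iff]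
  intro c hc
  have hcont := (hU.continuous φ).tendsto 0
  rw [hU.zero, Metric.tendsto_nhds_nhds] at hcont
  obtain ⟨δ, hδ, hs⟩ := hcont c hc
  filter_upwards [Metric.ball_mem_nhds (0 : ℝ) hδ] with t ht
  have ht' : |t| < δ := by simpa using ht
  have := h t c fun s hst => by
    have := (hs (x := s) (by simpa using hst.trans_lt ht')).le
    simpa [dist_eq_norm] using this
  simpa [hU.zero, sub_eq_add_neg, add_assoc] using this

theorem isClosed_inGenerator : IsClosed {p : E × E | InGenerator U p.1 p.2} := by
  refine isClosed_of_closure_subset ?_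
  rintro ⟨ψ, φ⟩ hp
  refine hU.inGenerator_of_norm_sub_le fun t C hC => ?_
  have key : ∀ ε > 0, ‖U t ψ - ψ + t • Complex.I • φ‖ ≤ C * |t| + ε * (3 * |t| + 2) := by
    intro ε hε
    obtain ⟨⟨ψ', φ'⟩, hg, hd⟩ := Metric.mem_closure_iff.mp hp ε hε
    rw [Prod.dist_eq, max_lt_iff] at hd
    simp only [dist_eq_norm] at hd
    obtain ⟨hd1, hd2⟩ := hd
    have h1 := hU.norm_sub_le_of_inGenerator (t := t) (C := C + 2 * ε) hg fun s hs => by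
      have e : U s φ' - φ' = (U s φ - φ) - (U s (φ - φ') - (φ - φ')) := by
        simp only [map_sub]; abel
      calc ‖U s φ' - φ'‖ ≤ ‖U s φ - φ‖ + (‖U s (φ - φ')‖ + ‖φ - φ'‖) := by
            rw [e]; exact (norm_sub_le _ _).trans (by gcongr; exact norm_sub_le _ _)
        _ ≤ C + (ε + ε) := by
            rw [hU.norm_map]; gcongr; exact hC s hs
        _ = _ := by ring
    have e : U t ψ - ψ + t • Complex.I • φ = (U t ψ' - ψ' + t • Complex.I • φ') +
        (U t (ψ - ψ') - (ψ - ψ') + t • Complex.I • (φ - φ')) := by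
      simp only [map_sub, smul_sub]; abel
    have h2 : ‖t • Complex.I • (φ - φ')‖ ≤ |t| * ε := by
      rw [norm_smul, norm_smul, Complex.norm_I, one_mul, Real.norm_eq_abs]; gcongr
    calc ‖U t ψ - ψ + t • Complex.I • φ‖
        ≤ (C + 2 * ε) * |t| + (‖U t (ψ - ψ')‖ + ‖ψ - ψ'‖ + |t| * ε) := by
          rw [e]
          refine (norm_add_le _ _).trans (add_le_add h1 ((norm_add_le _ _).trans ?_))
          exact add_le_add (norm_sub_le _ _) h2
      _ ≤ (C + 2 * ε) * |t| + (ε + ε + |t| * ε) := by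
          rw [hU.norm_map]; gcongr
      _ = _ := by ring
  have hpos : 0 < 3 * |t| + 2 := by positivity
  refine le_of_forall_pos_le_add fun ε hε => ?_
  have := key (ε / (3 * |t| + 2)) (by positivity)
  rwa [div_mul_cancel₀ _ hpos.ne'] at this

/-- Deficiency vectors of the restriction of the generator to an invariant dense domain vanish. -/
theorem eq_zero_of_mem_adjoint {g : Submodule ℂ (E × E)}
    (hgen : ∀ p ∈ g, InGenerator U p.1 p.2) (hdense : Dense (Prod.fst '' (g : Set (E × E))))
    (hinv : ∀ t, ∀ p ∈ g, ∃ φ, (U t p.1, φ) ∈ g) {σ : ℝ} (hσ : σ ^ 2 = 1) {w : E}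
    (hw : (w, (-(σ : ℂ) * Complex.I) • w) ∈ g.adjoint) : w = 0 := by
  rw [Submodule.mem_adjoint_iff] at hw
  refine hdense.eq_zero_of_inner_right ℂ ?_
  rintro _ ⟨⟨x, v⟩, hx, rfl⟩
  -- Invariance keeps `U t x` in the domain of `g`, so the adjoint relation for `w` applies at every
  -- time and yields the equation `y' = σ y`.
  have hf : ∀ t, HasDerivAt (fun t => inner ℂ (U t x) w) ((σ : ℂ) * inner ℂ (U t x) w) t := by
    intro t
    obtain ⟨v', hv'⟩ := hinv t _ hx
    have h1 : U t v = v' := by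
      have a := hU.inGenerator_map (hgen _ hx) t
      have b := HasDerivAt.unique a (hgen _ hv')
      simpa using b
    have h2 := (hU.hasDerivAt (hgen _ hx) t).inner ℂ (hasDerivAt_const t w)
    have h3 : inner ℂ v' w - inner ℂ (U t x) ((-(σ : ℂ) * Complex.I) • w) = 0 := hw _ _ hv'
    rw [inner_smul_right] at h3
    have h4 : inner ℂ (U t x) (0 : E) + inner ℂ (-Complex.I • U t v) w =
        (σ : ℂ) * inner ℂ (U t x) w := by
      simp only [h1, inner_zero_right, zero_add, inner_smul_left, map_neg, Complex.conj_I, neg_neg]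
      have hI := Complex.I_mul_I
      linear_combination Complex.I * h3 - σ * inner ℂ (U t x) w * hI
    exact h4 ▸ h2
  have hconst : ∀ t : ℝ, inner ℂ (U t x) w * Complex.exp (-(σ * t : ℝ)) = inner ℂ x w := by
    have hd : ∀ t : ℝ, HasDerivAt
        (fun t : ℝ => inner ℂ (U t x) w * Complex.exp (-(σ * t : ℝ))) 0 t := by
      intro t
      have h1 : HasDerivAt (fun t : ℝ => Complex.exp (-(σ * t : ℝ)))
          (Complex.exp (-(σ * t : ℝ)) * (-(σ : ℂ))) t := by
        have : HasDerivAt (fun t : ℝ => (-(σ * t : ℝ) : ℂ)) (-(σ : ℂ)) t := by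
          have := (((hasDerivAt_id t).const_mul σ).ofReal_comp).neg
          simpa only [id, mul_one] using! this
        exact this.cexp
      have h2 := (hf t).mul h1
      have e : (σ : ℂ) * inner ℂ (U t x) w * Complex.exp (-(σ * t : ℝ)) +
          inner ℂ (U t x) w * (Complex.exp (-(σ * t : ℝ)) * -(σ : ℂ)) = 0 := by ring
      rw [e] at h2
      exact h2
    intro t
    have := is_const_of_deriv_eq_zero (fun t => (hd t).differentiableAt)
      (fun t => (hd t).deriv) t 0
    simpa [hU.zero] using this
  -- The solution `e^{σt} ⟨x, w⟩` is evaluated at time `σN`, where the exponent is `σ²N = N` for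
  -- either sign; unitarity keeps it bounded.
  have hbound : ∀ N : ℕ, ‖inner ℂ x w‖ * Real.exp N ≤ ‖x‖ * ‖w‖ := by
    intro N
    have h1 := hconst (σ * N)
    rw [← h1, norm_mul, ← Complex.ofReal_neg, Complex.norm_exp_ofReal, mul_assoc, ← Real.exp_add]
    have : -(σ * (σ * N)) + (N : ℝ) = 0 := by linear_combination (-(N : ℝ)) * hσ
    rw [this, Real.exp_zero, mul_one]
    exact (norm_inner_le_norm _ _).trans (by rw [hU.norm_map])
  by_contra hne
  have hpos : 0 < ‖inner ℂ x w‖ := norm_pos_iff.mpr hne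
  obtain ⟨N, hN⟩ := exists_nat_gt (‖x‖ * ‖w‖ / ‖inner ℂ x w‖)
  rw [div_lt_iff₀ hpos] at hN
  have h2 := Real.add_one_le_exp (N : ℝ)
  nlinarith [hbound N]

end IsStrongUnitaryGroup

omit [CompleteSpace E] in
theorem Submodule.adjoint_anti {g h : Submodule ℂ (E × E)} (hgh : g ≤ h) :
    h.adjoint ≤ g.adjoint := by
  intro p hp
  rw [Submodule.mem_adjoint_iff] at hp ⊢
  exact fun a b hab => hp a b (hgh hab)

omit [CompleteSpace E] in
theorem Submodule.isClosed_adjoint (g : Submodule ℂ (E × E)) :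
    IsClosed (g.adjoint : Set (E × E)) := by
  have : (g.adjoint : Set (E × E)) =
      ⋂ q ∈ g, {p : E × E | inner ℂ q.2 p.1 - inner ℂ q.1 p.2 = 0} := by
    ext p
    simp only [SetLike.mem_coe, Submodule.mem_adjoint_iff, Set.mem_iInter, Set.mem_ofPred_eq,
      Prod.forall]
  rw [this]
  refine isClosed_biInter fun q _ => isClosed_eq ?_ continuous_const
  fun_prop

omit [CompleteSpace E] in
theorem Submodule.adjoint_topologicalClosure (g : Submodule ℂ (E × E)) :
    g.topologicalClosure.adjoint = g.adjoint := by
  refine le_antisymm (Submodule.adjoint_anti g.le_topologicalClosure) fun p hp => ?_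
  rw [Submodule.mem_adjoint_iff] at hp ⊢
  have hcl : IsClosed {q : E × E | inner ℂ q.2 p.1 - inner ℂ q.1 p.2 = 0} :=
    isClosed_eq (by fun_prop) continuous_const
  intro a b hab
  exact closure_minimal (s := (g : Set (E × E))) (fun q hq => hp q.1 q.2 hq) hcl hab

/-- Von Neumann: a symmetric relation without deficiency vectors has self-adjoint closure. -/
theorem Submodule.adjoint_eq_topologicalClosure {g : Submodule ℂ (E × E)} (hsymm : g ≤ g.adjoint)
    (hdef : ∀ σ : ℝ, σ ^ 2 = 1 → ∀ w, (w, (-(σ : ℂ) * Complex.I) • w) ∈ g.adjoint → w = 0) :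
    g.adjoint = g.topologicalClosure := by
  have hcl : g.topologicalClosure ≤ g.adjoint :=
    g.topologicalClosure_minimal hsymm g.isClosed_adjoint
  refine le_antisymm ?_ hcl
  rintro p hp
  -- `E × E` carries the sup norm; orthogonal projection onto the closed graph needs the Hilbert
  -- norm.
  let e := WithLp.prodContinuousLinearEquiv 2 ℂ E E
  let M : Submodule ℂ (WithLp 2 (E × E)) := g.topologicalClosure.comap e.toLinearMap
  have hM : IsClosed (M : Set (WithLp 2 (E × E))) :=
    g.isClosed_topologicalClosure.preimage e.continuous
  have : CompleteSpace M := hM.completeSpace_coe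
  obtain ⟨k, hk, q, hq, hpq⟩ := M.exists_add_mem_mem_orthogonal (WithLp.toLp 2 p)
  obtain ⟨⟨a, b⟩, rfl⟩ := (WithLp.toLp_surjective 2) q
  obtain ⟨k, rfl⟩ := (WithLp.toLp_surjective 2) k
  have hk' : k ∈ g.topologicalClosure := hk
  have hpq' : p = k + (a, b) := by
    have := congrArg WithLp.ofLp hpq
    simpa using this
  have h1 : (a, b) ∈ g.adjoint := by
    have : (a, b) = p - k := by rw [hpq']; abel
    rw [this]; exact sub_mem hp (hcl hk')
  -- Orthogonality of `(a, b)` to the graph is membership of its rotation by a right angle in the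
  -- adjoint.
  have h2 : (b, -a) ∈ g.adjoint := by
    rw [Submodule.mem_adjoint_iff]
    intro x v hxv
    have := (Submodule.mem_orthogonal _ _).mp hq (WithLp.toLp 2 (x, v))
      (g.le_topologicalClosure hxv)
    rw [WithLp.prod_inner_apply] at this
    simp only [inner_neg_right, sub_neg_eq_add]
    rw [add_comm]
    simpa using this
  -- Combining `(a, b)` with its rotation diagonalises the rotation: `a ± i b` are deficiency
  -- vectors, hence both vanish.
  have hz : ∀ σ : ℝ, σ ^ 2 = 1 → a + ((σ : ℂ) * Complex.I) • b = 0 := by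
    intro σ hσ
    refine hdef σ hσ _ ?_
    have : (σ : ℂ) * Complex.I * ((σ : ℂ) * Complex.I) = -1 := by
      have hσ' : (σ : ℂ) ^ 2 = 1 := by exact_mod_cast hσ
      have hI := Complex.I_sq
      linear_combination Complex.I ^ 2 * hσ' + hI
    have h3 := add_mem h1 (g.adjoint.smul_mem ((σ : ℂ) * Complex.I) h2)
    have e : (a + ((σ : ℂ) * Complex.I) • b, (-(σ : ℂ) * Complex.I) •
        (a + ((σ : ℂ) * Complex.I) • b)) = (a, b) + ((σ : ℂ) * Complex.I) • (b, -a) := by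
      refine Prod.ext rfl ?_
      simp only [Prod.snd_add, Prod.smul_snd, smul_add, smul_smul, smul_neg, neg_mul, neg_smul,
        this]
      simp only [one_smul, neg_neg]; abel
    rw [e]; exact h3
  have hp1 := hz 1 (by norm_num)
  have hp2 := hz (-1) (by norm_num)
  have ha : a = 0 := by
    have h3 : (2 : ℂ) • a = 0 := by
      have := congrArg₂ (· + ·) hp1 hp2
      simp only [Complex.ofReal_one, one_mul, Complex.ofReal_neg, neg_mul, neg_smul,
        add_zero] at this
      rw [two_smul, ← this]; abel
    simpa using h3
  have hb : b = 0 := by simpa [ha] using hp1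
  rw [hpq', ha, hb, Prod.mk_zero_zero, add_zero]
  exact hk'

theorem IsStrongUnitaryGroup.adjoint_eq_topologicalClosure {U : ℝ → E →L[ℂ] E}
    (hU : IsStrongUnitaryGroup U) {g : Submodule ℂ (E × E)}
    (hgen : ∀ p ∈ g, InGenerator U p.1 p.2) (hdense : Dense (Prod.fst '' (g : Set (E × E))))
    (hinv : ∀ t, ∀ p ∈ g, ∃ φ, (U t p.1, φ) ∈ g) :
    g.adjoint = g.topologicalClosure := by
  refine Submodule.adjoint_eq_topologicalClosure (fun p hp => ?_) fun σ hσ w hw =>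
    hU.eq_zero_of_mem_adjoint hgen hdense hinv hσ hw
  rw [Submodule.mem_adjoint_iff]
  intro a b hab
  rw [hU.inner_eq_of_inGenerator (hgen _ hab) (hgen _ hp), sub_self]

theorem IsStrongUnitaryGroup.mem_topologicalClosure_iff {U : ℝ → E →L[ℂ] E}
    (hU : IsStrongUnitaryGroup U) {g : Submodule ℂ (E × E)}
    (hgen : ∀ p ∈ g, InGenerator U p.1 p.2) (hdense : Dense (Prod.fst '' (g : Set (E × E))))
    (hinv : ∀ t, ∀ p ∈ g, ∃ φ, (U t p.1, φ) ∈ g) (ψ φ : E) :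
    (ψ, φ) ∈ g.topologicalClosure ↔ InGenerator U ψ φ := by
  constructor
  · intro h
    exact closure_minimal (s := (g : Set (E × E))) hgen hU.isClosed_inGenerator h
  · intro h
    rw [← hU.adjoint_eq_topologicalClosure hgen hdense hinv, Submodule.mem_adjoint_iff]
    intro a b hab
    rw [hU.inner_eq_of_inGenerator (hgen _ hab) h, sub_self]

/-- A symmetric operator that extends the restriction of the generator of `U` to an invariant dense
domain is essentially self-adjoint, and its closure generates `U`. -/
theorem IsStrongUnitaryGroup.isEssentiallySelfAdjoint {U : ℝ → E →L[ℂ] E}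
    (hU : IsStrongUnitaryGroup U) {T : E →ₗ.[ℂ] E} (hT : T.IsFormalAdjoint T)
    {g : Submodule ℂ (E × E)} (hgT : g ≤ T.graph)
    (hgen : ∀ p ∈ g, InGenerator U p.1 p.2) (hdense : Dense (Prod.fst '' (g : Set (E × E))))
    (hinv : ∀ t, ∀ p ∈ g, ∃ φ, (U t p.1, φ) ∈ g) :
    IsEssentiallySelfAdjoint T ∧ IsUnitaryGroupOf T.closure U := by
  have hdom : Dense (T.domain : Set E) := by
    refine hdense.mono ?_
    rintro _ ⟨p, hp, rfl⟩
    exact LinearPMap.mem_domain_of_mem_graph (hgT hp)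
  have hclos : T.IsClosable := by
    rw [LinearPMap.isClosable_iff_exists_closed_extension]
    exact ⟨T†, LinearPMap.adjoint_isClosed hdom, hT.le_adjoint hdom⟩
  have hadj := hU.adjoint_eq_topologicalClosure hgen hdense hinv
  have hTsymm : T.graph ≤ T.graph.adjoint := by
    rw [← LinearPMap.adjoint_graph_eq_graph_adjoint hdom]
    exact LinearPMap.le_graph_of_le (hT.le_adjoint hdom)
  -- Passing to adjoints reverses inclusions: `T ⊆ T* ⊆ g* = closure of g`, so enlarging the core to
  -- `T` does not enlarge the closure.
  have hTg : T.graph ≤ g.topologicalClosure := by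
    rw [← hadj]; exact hTsymm.trans (Submodule.adjoint_anti hgT)
  have hgraph : T.closure.graph = g.topologicalClosure := by
    rw [← hclos.graph_closure_eq_closure_graph]
    exact le_antisymm (T.graph.topologicalClosure_minimal hTg g.isClosed_topologicalClosure)
      (Submodule.topologicalClosure_mono hgT)
  have hdom' : Dense (T.closure.domain : Set E) := hdom.mono T.le_closure.1
  refine ⟨⟨hdom, hclos, ?_⟩, hU.unitary, hU.zero, hU.add, hU.continuous, fun ψ φ => ?_⟩
  · rw [LinearPMap.isSelfAdjoint_def]
    apply LinearPMap.eq_of_eq_graph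
    rw [LinearPMap.adjoint_graph_eq_graph_adjoint hdom', hgraph,
      Submodule.adjoint_topologicalClosure, hadj]
  · rw [hgraph]
    exact hU.mem_topologicalClosure_iff hgen hdense hinv ψ φ

theorem IsUnitaryGroupOf.unique {T : E →ₗ.[ℂ] E} (hT : Dense (T.domain : Set E))
    {U V : ℝ → E →L[ℂ] E} (hU : IsUnitaryGroupOf T U) (hV : IsUnitaryGroupOf T V) : U = V := by
  funext t
  have hU' := hU.isStrongUnitaryGroup
  have hV' := hV.isStrongUnitaryGroup
  refine DFunLike.coe_injective ((U t).continuous.ext_on hT (V t).continuous fun ψ hψ => ?_)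
  have hmem : (ψ, T ⟨ψ, hψ⟩) ∈ T.graph := T.mem_graph ⟨ψ, hψ⟩
  have hgU := (hU.generator _ _).mp hmem
  have hgV := (hV.generator _ _).mp hmem
  -- Both orbits stay in the domain of `T`, so the difference `D` satisfies `D' = -i T D`; symmetry
  -- makes `⟨D, T D⟩` real, and `2 Re ⟨D, -i T D⟩ = 0`.
  have hd : ∀ s, HasDerivAt (fun s => ‖U s ψ - V s ψ‖ ^ 2) 0 s := by
    intro s
    have h1 := hU'.inGenerator_map hgU s
    have h2 := (hU.generator _ _).mpr h1
    have h3 := (hV.generator _ _).mpr (hV'.inGenerator_map hgV s)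
    have h4 := (hU.generator _ _).mp (T.graph.sub_mem h2 h3)
    have h5 := hU'.inner_eq_of_inGenerator h4 h4
    let _ : InnerProductSpace ℝ E := InnerProductSpace.rclikeToReal ℂ E
    have h6 := ((hU'.hasDerivAt hgU s).sub (hV'.hasDerivAt hgV s)).norm_sq
    have h9 : 2 * inner ℝ (U s ψ - V s ψ) (-Complex.I • U s (T ⟨ψ, hψ⟩) -
        -Complex.I • V s (T ⟨ψ, hψ⟩)) = 0 := ?_
    · exact h9 ▸ h6
    rw [← smul_sub, real_inner_eq_re_inner ℂ, inner_smul_right]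
    have h7 : (starRingEnd ℂ) (inner ℂ (U s ψ - V s ψ) (U s (T ⟨ψ, hψ⟩) - V s (T ⟨ψ, hψ⟩))) =
        inner ℂ (U s ψ - V s ψ) (U s (T ⟨ψ, hψ⟩) - V s (T ⟨ψ, hψ⟩)) := by
      rw [inner_conj_symm]; exact h5
    have h8 := Complex.conj_eq_iff_im.mp h7
    simp only [RCLike.re_to_complex, Complex.mul_re, Complex.neg_re, Complex.I_re,
      Complex.neg_im, Complex.I_im, h8]
    simp
  have := is_const_of_deriv_eq_zero (fun s => (hd s).differentiableAt) (fun s => (hd s).deriv) t 0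
  simp only [hU.zero, hV.zero, sub_self, norm_zero] at this
  have h0 : ‖U t ψ - V t ψ‖ = 0 := by simpa using this
  exact sub_eq_zero.mp (norm_eq_zero.mp h0)

end UnitaryGroups

/-! ### Symmetry of the Hamiltonian and its form as a first-order operator -/

section Symmetry

theorem inner_schwartzToL2 (f g : 𝓢(ℝ × ℝ, ℂ)) :
    inner ℂ (schwartzToL2 f) (schwartzToL2 g) = ∫ x, (starRingEnd ℂ) (f x) * g x := by
  have h := inner_toL2_toL2_eq f g (volume : Measure (ℝ × ℝ))
  refine h.trans (integral_congr_ae (Filter.Eventually.of_forall fun x => ?_))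
  simp [mul_comm]

theorem inner_opX (j : Fin 2) (f g : 𝓢(ℝ × ℝ, ℂ)) :
    inner ℂ (schwartzToL2 (opX j f)) (schwartzToL2 g) =
      inner ℂ (schwartzToL2 f) (schwartzToL2 (opX j g)) := by
  simp only [inner_schwartzToL2, opX_apply, map_mul, Complex.conj_ofReal]
  congr 1; funext x; ring

theorem inner_opP (j : Fin 2) (f g : 𝓢(ℝ × ℝ, ℂ)) :
    inner ℂ (schwartzToL2 (opP j f)) (schwartzToL2 g) =
      inner ℂ (schwartzToL2 f) (schwartzToL2 (opP j g)) := by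
  simp only [inner_schwartzToL2, opP_apply, map_mul, map_neg, Complex.conj_I, neg_neg]
  -- Integration by parts, with the sesquilinear pairing written as the real bilinear map `(z, w) ↦
  -- conj z * w`.
  have h := integral_bilinear_lineDerivOp_right_eq_neg_left (μ := (volume : Measure (ℝ × ℝ))) f g
    ((ContinuousLinearMap.mul ℝ ℂ).comp (Complex.conjCLE : ℂ →L[ℝ] ℂ)) (dir j)
  simp only [ContinuousLinearMap.comp_apply, ContinuousLinearMap.mul_apply',
    SchwartzMap.lineDerivOp_apply, ContinuousLinearEquiv.coe_coe, Complex.conjCLE_apply] at h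
  have e1 : ∀ x, Complex.I * (starRingEnd ℂ) (lineDeriv ℝ f x (dir j)) * g x =
      Complex.I * ((starRingEnd ℂ) (lineDeriv ℝ f x (dir j)) * g x) := fun x => by ring
  have e2 : ∀ x, (starRingEnd ℂ) (f x) * (-Complex.I * lineDeriv ℝ g x (dir j)) =
      -Complex.I * ((starRingEnd ℂ) (f x) * lineDeriv ℝ g x (dir j)) := fun x => by ring
  simp only [e1, e2, integral_const_mul, h]
  ring

theorem inner_opA (j : Fin 2) (f g : 𝓢(ℝ × ℝ, ℂ)) :
    inner ℂ (schwartzToL2 (opA j f)) (schwartzToL2 g) =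
      inner ℂ (schwartzToL2 f) (schwartzToL2 (opAdag j g)) := by
  simp only [opA, opAdag, smul_apply, add_apply, sub_apply, map_smul, map_add, map_sub,
    inner_smul_left, inner_smul_right, inner_add_left, inner_sub_right, inner_opX, inner_opP, map_inv₀, Complex.conj_ofReal,
    Complex.conj_I]
  ring

theorem inner_opAdag (j : Fin 2) (f g : 𝓢(ℝ × ℝ, ℂ)) :
    inner ℂ (schwartzToL2 (opAdag j f)) (schwartzToL2 g) =
      inner ℂ (schwartzToL2 f) (schwartzToL2 (opA j g)) := by
  rw [← inner_conj_symm, ← inner_opA, inner_conj_symm]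

theorem SchwartzMap.hasLineDerivAt (f : 𝓢(ℝ × ℝ, ℂ)) (x v : ℝ × ℝ) :
    HasLineDerivAt ℝ f (lineDeriv ℝ f x v) x v :=
  (f.differentiable x).lineDifferentiableAt.hasLineDerivAt

theorem lineDeriv_opX (i j : Fin 2) (f : 𝓢(ℝ × ℝ, ℂ)) (x : ℝ × ℝ) :
    lineDeriv ℝ (opX i f) x (dir j) =
      (coord i (dir j) : ℂ) * f x + (coord i x : ℂ) * lineDeriv ℝ f x (dir j) := by
  have hc : (opX i f : ℝ × ℝ → ℂ) = fun x => (coord i x : ℂ) * f x := by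
    funext y; exact opX_apply i f y
  rw [hc]
  refine HasLineDerivAt.lineDeriv ?_
  have hf := f.hasLineDerivAt x (dir j)
  unfold HasLineDerivAt at hf ⊢
  have h1 : HasDerivAt (fun t : ℝ => ((coord i (x + t • dir j) : ℝ) : ℂ))
      (coord i (dir j) : ℂ) 0 := by
    have h2 : HasDerivAt (fun t : ℝ => coord i x + t * coord i (dir j)) (coord i (dir j)) 0 := by
      simpa using ((hasDerivAt_id (0 : ℝ)).mul_const (coord i (dir j))).const_add (coord i x)
    simpa using! h2.ofReal_comp
  have h3 := h1.mul hf
  simpa using! h3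

theorem opP_opX (i j : Fin 2) (f : 𝓢(ℝ × ℝ, ℂ)) :
    opP j (opX i f) = opX i (opP j f) - (Complex.I * (coord i (dir j) : ℂ)) • f := by
  ext x
  simp only [opP_apply, lineDeriv_opX, opX_apply, sub_apply, smul_apply,
    smul_eq_mul]
  ring

theorem opX_zero_opP_one : opX 0 * opP 1 = opP 1 * opX 0 := by
  refine ContinuousLinearMap.ext fun f => ?_
  simp [mul_apply_eq_comp, opP_opX, coord, dir]

theorem opX_zero_opX_one : opX 0 * opX 1 = opX 1 * opX 0 := by
  refine ContinuousLinearMap.ext fun f => SchwartzMap.ext fun x => ?_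
  simp only [mul_apply_eq_comp, opX_apply]
  ring

theorem commute_opX_zero_opA_one : Commute (opX 0) (opA 1) :=
  Commute.smul_right (Commute.add_right opX_zero_opX_one
    (Commute.smul_right opX_zero_opP_one _)) _

theorem commute_opX_zero_opAdag_one : Commute (opX 0) (opAdag 1) :=
  Commute.smul_right (Commute.sub_right opX_zero_opX_one
    (Commute.smul_right opX_zero_opP_one _)) _

theorem onSchwartz_apply (C : 𝓢(ℝ × ℝ, ℂ) →L[ℂ] 𝓢(ℝ × ℝ, ℂ)) (k : 𝓢(ℝ × ℝ, ℂ)) :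
    onSchwartz C ⟨schwartzToL2 k, k, rfl⟩ = schwartzToL2 (C k) := by
  have : (LinearEquiv.ofInjective schwartzToL2 schwartzToL2_injective).symm
      ⟨schwartzToL2 k, k, rfl⟩ = k := by
    rw [LinearEquiv.symm_apply_eq]; rfl
  exact congrArg (fun k => schwartzToL2 (C k)) this

theorem onSchwartz_isFormalAdjoint {A B : 𝓢(ℝ × ℝ, ℂ) →L[ℂ] 𝓢(ℝ × ℝ, ℂ)}
    (h : ∀ f g, inner ℂ (schwartzToL2 (A f)) (schwartzToL2 g) =
      inner ℂ (schwartzToL2 f) (schwartzToL2 (B g))) :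
    (onSchwartz A).IsFormalAdjoint (onSchwartz B) := by
  rintro ⟨_, f, rfl⟩ ⟨_, g, rfl⟩
  exact (congrArg₂ (inner ℂ) (onSchwartz_apply A f) rfl).trans
    ((h f g).trans (congrArg₂ (inner ℂ) rfl (onSchwartz_apply B g).symm))

theorem mem_graph_onSchwartz (C : 𝓢(ℝ × ℝ, ℂ) →L[ℂ] 𝓢(ℝ × ℝ, ℂ)) (k : 𝓢(ℝ × ℝ, ℂ)) :
    (schwartzToL2 k, schwartzToL2 (C k)) ∈ (onSchwartz C).graph := by
  rw [LinearPMap.mem_graph_iff]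
  exact ⟨⟨schwartzToL2 k, k, rfl⟩, rfl, onSchwartz_apply C k⟩

/-- The Hamiltonian as an operator on the Schwartz space. -/
noncomputable def hamiltonianCLM : 𝓢(ℝ × ℝ, ℂ) →L[ℂ] 𝓢(ℝ × ℝ, ℂ) :=
  (Complex.I / 2) • (opX 0 ^ 4 * (opA 1 ^ 2 - opAdag 1 ^ 2))

theorem hamiltonian_isFormalAdjoint : hamiltonian.IsFormalAdjoint hamiltonian := by
  refine onSchwartz_isFormalAdjoint fun f g => ?_
  have hX : ∀ (n : ℕ) (f g : 𝓢(ℝ × ℝ, ℂ)), inner ℂ (schwartzToL2 ((opX 0 ^ n) f))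
      (schwartzToL2 g) = inner ℂ (schwartzToL2 f) (schwartzToL2 ((opX 0 ^ n) g)) := by
    intro n
    induction n with
    | zero => intro f g; rfl
    | succ n ih =>
      intro f g
      rw [pow_succ, mul_apply_eq_comp, ih, inner_opX, ← mul_apply_eq_comp, ← pow_succ', pow_succ]
  -- Taking adjoints reverses the product; the two factors act on different modes, so the order can
  -- be restored. The sign from swapping `a²` and `a†²` is absorbed by the conjugate of `I / 2`.
  have hcomm : opX 0 ^ 4 * (opA 1 ^ 2 - opAdag 1 ^ 2) =
      (opA 1 ^ 2 - opAdag 1 ^ 2) * opX 0 ^ 4 :=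
    Commute.sub_right (commute_opX_zero_opA_one.pow_pow 4 2)
      (commute_opX_zero_opAdag_one.pow_pow 4 2)
  conv_rhs => rw [hcomm]
  simp only [smul_apply, mul_apply_eq_comp, map_smul, inner_smul_left, inner_smul_right, hX]
  simp only [pow_two, sub_apply, mul_apply_eq_comp, map_sub, inner_sub_left, inner_sub_right,
    inner_opA, inner_opAdag, map_div₀, Complex.conj_I, map_ofNat]
  ring

/-- The second-order terms `X²` and `P²` cancel, which is why `H` is only a first-order operator and
generates a flow. -/
theorem opA_sq_sub_opAdag_sq : opA 1 ^ 2 - opAdag 1 ^ 2 =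
    Complex.I • (opX 1 * opP 1 + opP 1 * opX 1) := by
  have hs : ((Real.sqrt 2 : ℂ)⁻¹) * ((Real.sqrt 2 : ℂ)⁻¹) = 1 / 2 := by
    rw [← mul_inv, ← Complex.ofReal_mul, Real.mul_self_sqrt (by norm_num)]; norm_num
  simp only [opA, opAdag, pow_two, add_mul, mul_add, sub_mul, mul_sub,
    smul_mul_assoc, mul_smul_comm, ← smul_sub]
  match_scalars <;> first | ring1 | linear_combination (2 * Complex.I) * hs

theorem hamiltonianCLM_apply (f : 𝓢(ℝ × ℝ, ℂ)) (x : ℝ × ℝ) :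
    hamiltonianCLM f x = Complex.I * ((x.1 : ℂ) ^ 4 *
      ((x.2 : ℂ) * lineDeriv ℝ f x (0, 1) + f x / 2)) := by
  have hX : ∀ (n : ℕ) (f : 𝓢(ℝ × ℝ, ℂ)), (opX 0 ^ n) f x = (x.1 : ℂ) ^ n * f x := by
    intro n
    induction n with
    | zero => intro f; simp
    | succ n ih =>
      intro f
      rw [pow_succ, mul_apply_eq_comp, ih, opX_apply]
      simp [coord]; ring
  rw [hamiltonianCLM, opA_sq_sub_opAdag_sq]
  simp only [smul_apply, add_apply, mul_apply_eq_comp, hX, opP_opX, sub_apply, opX_apply,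
    opP_apply, map_smul, smul_eq_mul]
  simp only [coord, dir, Matrix.cons_val_one, Matrix.cons_val_fin_one,
    ContinuousLinearMap.coe_snd', Complex.ofReal_one]
  have hI := Complex.I_sq
  linear_combination (-(Complex.I * (x.1 : ℂ) ^ 4 *
      ((x.2 : ℂ) * lineDeriv ℝ f x (0, 1) + f x / 2))) * hI

end Symmetry

/-! ### The squeezing flow and its unitary action on `L²` -/

section Flow

/-- The flow of the squeezing field `x₀⁴ x₁ ∂₁`. -/
noncomputable def squeezeFlow (t : ℝ) (x : ℝ × ℝ) : ℝ × ℝ := (x.1, Real.exp (t * x.1 ^ 4) * x.2)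

/-- The pull-back of a function under `squeezeFlow t`, weighted by the square root of the
Jacobian. -/
noncomputable def pullback (t : ℝ) (f : ℝ × ℝ → ℂ) (x : ℝ × ℝ) : ℂ :=
  (Real.exp (t * x.1 ^ 4 / 2) : ℂ) * f (squeezeFlow t x)

theorem squeezeFlow_squeezeFlow (s t : ℝ) (x : ℝ × ℝ) :
    squeezeFlow t (squeezeFlow s x) = squeezeFlow (s + t) x := by
  simp only [squeezeFlow, Prod.mk.injEq, true_and]
  rw [← mul_assoc, ← Real.exp_add]; ring_nf

theorem squeezeFlow_zero (x : ℝ × ℝ) : squeezeFlow 0 x = x := by simp [squeezeFlow]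

theorem contDiff_squeezeFlow (t : ℝ) : ContDiff ℝ (⊤ : ℕ∞) (squeezeFlow t) := by
  unfold squeezeFlow; fun_prop

theorem continuous_squeezeFlow : Continuous fun p : ℝ × (ℝ × ℝ) => squeezeFlow p.1 p.2 := by
  unfold squeezeFlow; fun_prop

theorem pullback_pullback (s t : ℝ) (f : ℝ × ℝ → ℂ) :
    pullback s (pullback t f) = pullback (s + t) f := by
  funext x
  simp only [pullback, squeezeFlow_squeezeFlow]
  rw [← mul_assoc, ← Complex.ofReal_mul, ← Real.exp_add]
  congr 3
  simp only [squeezeFlow]; ring_nf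

theorem pullback_zero (f : ℝ × ℝ → ℂ) : pullback 0 f = f := by
  funext x; simp [pullback, squeezeFlow_zero]

theorem measurable_squeezeFlow (t : ℝ) : Measurable (squeezeFlow t) :=
  (contDiff_squeezeFlow t).continuous.measurable

theorem lintegral_comp_mul_left {c : ℝ} (hc : 0 < c) {g : ℝ → ℝ≥0∞} (hg : Measurable g) :
    ∫⁻ y, ENNReal.ofReal c * g (c * y) = ∫⁻ y, g y := by
  conv_rhs => rw [← Real.smul_map_volume_mul_left hc.ne']
  rw [lintegral_smul_measure, lintegral_map hg (by fun_prop), abs_of_pos hc,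
    lintegral_const_mul _ (by fun_prop), smul_eq_mul]

/-- For fixed `x₀` the flow is a dilation of the line, so Tonelli reduces the Jacobian formula to
one-dimensional scaling. -/
theorem lintegral_squeezeFlow (t : ℝ) {g : ℝ × ℝ → ℝ≥0∞} (hg : Measurable g) :
    ∫⁻ x, ENNReal.ofReal (Real.exp (t * x.1 ^ 4)) * g (squeezeFlow t x) = ∫⁻ x, g x := by
  have hm := measurable_squeezeFlow t
  rw [Measure.volume_eq_prod, lintegral_prod _ (by fun_prop), lintegral_prod _ (by fun_prop)]
  refine lintegral_congr fun a => ?_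
  exact lintegral_comp_mul_left (Real.exp_pos (t * a ^ 4)) (g := fun y => g (a, y)) (by fun_prop)

/-- Needed for composition with the flow to be well defined on almost-everywhere classes; it follows
from the Jacobian formula since the Jacobian never vanishes. -/
theorem quasiMeasurePreserving_squeezeFlow (t : ℝ) :
    Measure.QuasiMeasurePreserving (squeezeFlow t) volume volume := by
  refine ⟨measurable_squeezeFlow t, Measure.AbsolutelyContinuous.mk fun s hs h0 => ?_⟩
  rw [Measure.map_apply (measurable_squeezeFlow t) hs]
  have h1 := lintegral_squeezeFlow t (g := s.indicator 1) (measurable_one.indicator hs)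
  rw [lintegral_indicator_one hs, h0, lintegral_eq_zero_iff] at h1
  · rw [← compl_mem_ae_iff]
    filter_upwards [h1] with x hx hxs
    have : ENNReal.ofReal (Real.exp (t * x.1 ^ 4)) ≠ 0 := by simpa using Real.exp_pos _
    have hxs' : squeezeFlow t x ∈ s := hxs
    simp [hxs', this] at hx
  · have := measurable_squeezeFlow t
    have h2 : Measurable (s.indicator (1 : ℝ × ℝ → ℝ≥0∞)) := measurable_one.indicator hs
    fun_prop

theorem pullback_ae_congr (t : ℝ) {f g : ℝ × ℝ → ℂ} (h : f =ᵐ[volume] g) :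
    pullback t f =ᵐ[volume] pullback t g := by
  filter_upwards [(quasiMeasurePreserving_squeezeFlow t).ae h] with x hx
  simp [pullback, hx]

/-- The square of the weight in `pullback` is exactly the Jacobian of the flow. -/
theorem eLpNorm_pullback (t : ℝ) {f : ℝ × ℝ → ℂ} (hf : AEStronglyMeasurable f volume) :
    eLpNorm (pullback t f) 2 volume = eLpNorm f 2 volume := by
  rw [eLpNorm_congr_ae hf.ae_eq_mk, eLpNorm_congr_ae (pullback_ae_congr t hf.ae_eq_mk)]
  have hm := hf.stronglyMeasurable_mk.measurable
  set g := hf.mk f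
  rw [eLpNorm_eq_lintegral_rpow_enorm_toReal (by norm_num) (by norm_num),
    eLpNorm_eq_lintegral_rpow_enorm_toReal (by norm_num) (by norm_num)]
  congr 1
  rw [← lintegral_squeezeFlow t (g := fun x => ‖g x‖ₑ ^ (2 : ℝ≥0∞).toReal) (by fun_prop)]
  refine lintegral_congr fun x => ?_
  simp only [pullback, enorm_mul, ENNReal.toReal_ofNat, ENNReal.rpow_ofNat, mul_pow]
  congr 1
  rw [← ofReal_norm, Complex.norm_real, Real.norm_eq_abs, abs_of_pos (Real.exp_pos _),
    ← ENNReal.ofReal_pow (Real.exp_pos _).le, ← Real.exp_nat_mul]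
  congr 2; push_cast; ring

theorem memLp_pullback (t : ℝ) {f : ℝ × ℝ → ℂ} (hf : MemLp f 2 volume) :
    MemLp (pullback t f) 2 volume := by
  refine ⟨?_, by rw [eLpNorm_pullback t hf.1]; exact hf.2⟩
  refine AEStronglyMeasurable.mul ?_
    (hf.1.comp_quasiMeasurePreserving (quasiMeasurePreserving_squeezeFlow t))
  exact (by fun_prop : Continuous fun x : ℝ × ℝ =>
    (Real.exp (t * x.1 ^ 4 / 2) : ℂ)).aestronglyMeasurable

/-- The action of `pullback t` on `L²(ℝ²)`. -/
noncomputable def pullbackIsometry (t : ℝ) : TwoModeSpace →ₗᵢ[ℂ] TwoModeSpace where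
  toFun f := (memLp_pullback t (Lp.memLp f)).toLp
  map_add' f g := by
    rw [← MemLp.toLp_add, MemLp.toLp_eq_toLp_iff]
    refine (pullback_ae_congr t (Lp.coeFn_add f g)).trans (Filter.Eventually.of_forall fun x => ?_)
    simp [pullback, mul_add]
  map_smul' c f := by
    rw [RingHom.id_apply, ← MemLp.toLp_const_smul, MemLp.toLp_eq_toLp_iff]
    refine (pullback_ae_congr t (Lp.coeFn_smul c f)).trans (Filter.Eventually.of_forall fun x => ?_)
    simp [pullback, mul_left_comm]
  norm_map' f := by
    change ‖(memLp_pullback t (Lp.memLp f)).toLp‖ = _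
    rw [Lp.norm_toLp, eLpNorm_pullback t (Lp.memLp f).1, Lp.norm_def]

/-- The unitary group generated by the Hamiltonian. -/
noncomputable def squeezeGroup (t : ℝ) : TwoModeSpace →L[ℂ] TwoModeSpace :=
  (pullbackIsometry t).toContinuousLinearMap

theorem coeFn_squeezeGroup (t : ℝ) (f : TwoModeSpace) :
    squeezeGroup t f =ᵐ[volume] pullback t f :=
  MemLp.coeFn_toLp (memLp_pullback t (Lp.memLp f))

theorem norm_squeezeGroup (t : ℝ) (f : TwoModeSpace) : ‖squeezeGroup t f‖ = ‖f‖ :=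
  (pullbackIsometry t).norm_map f

theorem squeezeGroup_zero : squeezeGroup 0 = 1 := by
  refine ContinuousLinearMap.ext fun f => Lp.ext ?_
  refine (coeFn_squeezeGroup 0 f).trans ?_
  rw [pullback_zero]; rfl

theorem squeezeGroup_add (s t : ℝ) : squeezeGroup (s + t) = squeezeGroup s * squeezeGroup t := by
  refine ContinuousLinearMap.ext fun f => Lp.ext ?_
  rw [mul_apply_eq_comp]
  refine (coeFn_squeezeGroup _ f).trans ?_
  rw [← pullback_pullback]
  exact ((coeFn_squeezeGroup s _).trans (pullback_ae_congr s (coeFn_squeezeGroup t f))).symm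

theorem squeezeGroup_mem_unitary (t : ℝ) :
    squeezeGroup t ∈ unitary (TwoModeSpace →L[ℂ] TwoModeSpace) := by
  have h1 : star (squeezeGroup t) * squeezeGroup t = 1 :=
    (ContinuousLinearMap.norm_map_iff_adjoint_comp_self _).mp (norm_squeezeGroup t)
  have h2 : squeezeGroup t * squeezeGroup (-t) = 1 := by
    rw [← squeezeGroup_add, add_neg_cancel, squeezeGroup_zero]
  have h3 : star (squeezeGroup t) = squeezeGroup (-t) := left_inv_eq_right_inv h1 h2
  rw [Unitary.mem_iff]
  exact ⟨h1, by rw [h3, h2]⟩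

end Flow

/-! ### Compactly supported smooth functions as an invariant core -/

section Core

/-- Schwartz functions with compact support. -/
def compactlySupportedSchwartz : Submodule ℂ 𝓢(ℝ × ℝ, ℂ) where
  carrier := {f | HasCompactSupport f}
  zero_mem' := HasCompactSupport.zero
  add_mem' := fun hf hg => HasCompactSupport.add hf hg
  smul_mem' := fun c _ hf => hf.smul_left (f := fun _ => c)

theorem hasCompactSupport_pullback (t : ℝ) {f : ℝ × ℝ → ℂ} (hf : HasCompactSupport f) :
    HasCompactSupport (pullback t f) := by
  refine HasCompactSupport.mul_left (f' := f ∘ squeezeFlow t) ?_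
  refine HasCompactSupport.comp_homeomorph hf
    { toFun := squeezeFlow t
      invFun := squeezeFlow (-t)
      left_inv := fun x => by rw [squeezeFlow_squeezeFlow, add_neg_cancel, squeezeFlow_zero]
      right_inv := fun x => by rw [squeezeFlow_squeezeFlow, neg_add_cancel, squeezeFlow_zero]
      continuous_toFun := (contDiff_squeezeFlow t).continuous
      continuous_invFun := (contDiff_squeezeFlow (-t)).continuous }

theorem contDiff_pullback (t : ℝ) {f : ℝ × ℝ → ℂ} (hf : ContDiff ℝ (⊤ : ℕ∞) f) :
    ContDiff ℝ (⊤ : ℕ∞) (pullback t f) := by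
  have h1 : ContDiff ℝ (⊤ : ℕ∞) fun x : ℝ × ℝ => (Real.exp (t * x.1 ^ 4 / 2) : ℂ) :=
    Complex.ofRealCLM.contDiff.comp (Real.contDiff_exp.comp
      (f := fun x : ℝ × ℝ => t * x.1 ^ 4 / 2) (by fun_prop))
  exact h1.mul (hf.comp (contDiff_squeezeFlow t))

theorem coeFn_schwartzToL2 (f : 𝓢(ℝ × ℝ, ℂ)) : schwartzToL2 f =ᵐ[volume] f :=
  f.coeFn_toLp 2 volume

theorem schwartzToL2_eq_iff {f : 𝓢(ℝ × ℝ, ℂ)} {ψ : TwoModeSpace} :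
    ψ = schwartzToL2 f ↔ ψ =ᵐ[volume] f := by
  constructor
  · rintro rfl; exact coeFn_schwartzToL2 f
  · intro h; exact Lp.ext (h.trans (coeFn_schwartzToL2 f).symm)

/-- Invariance of the core: the flow is a smooth homeomorphism, and on a compact support the growth
of `e^{t x₀⁴}` is irrelevant. -/
theorem exists_squeezeGroup_eq (t : ℝ) {f : 𝓢(ℝ × ℝ, ℂ)} (hf : f ∈ compactlySupportedSchwartz) :
    ∃ k ∈ compactlySupportedSchwartz, squeezeGroup t (schwartzToL2 f) = schwartzToL2 k ∧
      ⇑k = pullback t f := by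
  have h1 : HasCompactSupport (pullback t f) := hasCompactSupport_pullback t hf
  refine ⟨h1.toSchwartzMap (contDiff_pullback t (f.smooth ⊤)), h1, ?_, rfl⟩
  rw [schwartzToL2_eq_iff]
  exact (coeFn_squeezeGroup t _).trans (pullback_ae_congr t (coeFn_schwartzToL2 f))

/-- The generator `x₀⁴ (x₁ ∂₁ + 1/2)` of the flow. -/
noncomputable def squeezeGenerator : 𝓢(ℝ × ℝ, ℂ) →L[ℂ] 𝓢(ℝ × ℝ, ℂ) := -Complex.I • hamiltonianCLM

theorem squeezeGenerator_apply (f : 𝓢(ℝ × ℝ, ℂ)) (x : ℝ × ℝ) :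
    squeezeGenerator f x = (x.1 : ℂ) ^ 4 * ((x.2 : ℂ) * lineDeriv ℝ f x (0, 1) + f x / 2) := by
  rw [squeezeGenerator, smul_apply, smul_apply, hamiltonianCLM_apply, smul_eq_mul]
  have hI := Complex.I_sq
  linear_combination (-((x.1 : ℂ) ^ 4 *
      ((x.2 : ℂ) * lineDeriv ℝ f x (0, 1) + f x / 2))) * hI

theorem squeezeGenerator_eq_zero {f : 𝓢(ℝ × ℝ, ℂ)} {x : ℝ × ℝ} (hx : x ∉ tsupport f) :
    squeezeGenerator f x = 0 := by
  rw [squeezeGenerator_apply, image_eq_zero_of_notMem_tsupport hx,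
    ((f.differentiable x).lineDeriv_eq_fderiv), fderiv_of_notMem_tsupport ℝ hx]
  simp

theorem tsupport_squeezeGenerator_subset (f : 𝓢(ℝ × ℝ, ℂ)) :
    tsupport (squeezeGenerator f) ⊆ tsupport f :=
  closure_minimal (fun _ hx => by_contra fun h => hx (squeezeGenerator_eq_zero h))
    (isClosed_tsupport f)

/-- Chain rule along the flow. Because the derivative is again a pullback of a Schwartz function,
the lemma can be iterated to get second derivatives in `t`. -/
theorem hasDerivAt_pullback (f : 𝓢(ℝ × ℝ, ℂ)) (x : ℝ × ℝ) (t : ℝ) :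
    HasDerivAt (fun t => pullback t f x) (pullback t (squeezeGenerator f) x) t := by
  have h1 : HasDerivAt (fun t : ℝ => (Real.exp (t * x.1 ^ 4 / 2) : ℂ))
      ((Real.exp (t * x.1 ^ 4 / 2) * (x.1 ^ 4 / 2) : ℝ) : ℂ) t := by
    refine HasDerivAt.ofReal_comp (HasDerivAt.exp ?_)
    simpa [mul_div_assoc] using (hasDerivAt_id t).mul_const (x.1 ^ 4 / 2)
  have h2 : HasDerivAt (fun t : ℝ => squeezeFlow t x)
      (0, Real.exp (t * x.1 ^ 4) * x.1 ^ 4 * x.2) t := by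
    refine (hasDerivAt_const t x.1).prodMk (HasDerivAt.mul_const ?_ x.2)
    refine HasDerivAt.exp ?_
    simpa using (hasDerivAt_id t).mul_const (x.1 ^ 4)
  have h3 := (f.differentiable (squeezeFlow t x)).hasFDerivAt.comp_hasDerivAt t h2
  have h4 := h1.mul h3
  refine h4.congr_deriv ?_
  rw [pullback, squeezeGenerator_apply, (f.differentiable _).lineDeriv_eq_fderiv]
  have e : ((0, Real.exp (t * x.1 ^ 4) * x.1 ^ 4 * x.2) : ℝ × ℝ) =
      (Real.exp (t * x.1 ^ 4) * x.1 ^ 4 * x.2) • (0, 1) := by simp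
  rw [e, map_smul, Complex.real_smul]
  simp only [squeezeFlow, Function.comp]
  push_cast
  ring

/-- Second order Taylor bound. -/
theorem norm_sub_sub_le_of_hasDerivAt {F G H : ℝ → ℂ} {C t : ℝ}
    (hF : ∀ s, HasDerivAt F (G s) s) (hG : ∀ s, HasDerivAt G (H s) s)
    (hC : ∀ s ∈ Set.uIcc 0 t, ‖H s‖ ≤ C) : ‖F t - F 0 - t • G 0‖ ≤ C * |t| ^ 2 := by
  have h0 : (0 : ℝ) ∈ Set.uIcc 0 t := Set.left_mem_uIcc
  have hC0 : 0 ≤ C := (norm_nonneg _).trans (hC 0 h0)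
  have h1 : ∀ s ∈ Set.uIcc 0 t, ‖G s - (1 : ℝ) • G 0‖ ≤ C * |t| := by
    intro s hs
    have := (convex_uIcc (0 : ℝ) t).norm_image_sub_le_of_norm_hasDerivWithin_le
      (fun s _ => (hG s).hasDerivWithinAt) hC h0 hs
    rw [one_smul]
    refine this.trans ?_
    rw [Real.norm_eq_abs]
    refine mul_le_mul_of_nonneg_left ?_ hC0
    simpa using Set.abs_sub_left_of_mem_uIcc hs
  have h2 := (convex_uIcc (0 : ℝ) t).norm_image_sub_le_of_norm_hasDerivWithin_le
    (f := fun s => F s - s • G 0)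
    (fun s _ => ((hF s).sub ((hasDerivAt_id s).smul_const (G 0))).hasDerivWithinAt) h1 h0
    Set.right_mem_uIcc
  simp only [zero_smul, sub_zero, Real.norm_eq_abs] at h2
  calc ‖F t - F 0 - t • G 0‖ = ‖F t - t • G 0 - F 0‖ := by congr 1; abel
    _ ≤ C * |t| * |t| := h2
    _ = _ := by ring

theorem norm_le_of_ae_eq_of_bound {ψ : TwoModeSpace} {k : ℝ × ℝ → ℂ} (h : ψ =ᵐ[volume] k)
    {K : Set (ℝ × ℝ)} (hK : IsCompact K) {M : ℝ} (hM : 0 ≤ M) (hb : ∀ x, ‖k x‖ ≤ M)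
    (h0 : ∀ x ∉ K, k x = 0) : ‖ψ‖ ≤ M * (volume K ^ (1 / (2 : ℝ≥0∞).toReal)).toReal := by
  rw [Lp.norm_def, eLpNorm_congr_ae h]
  have h1 : eLpNorm k 2 volume ≤ eLpNorm (K.indicator fun _ => M) 2 volume := by
    refine eLpNorm_mono_real fun x => ?_
    by_cases hx : x ∈ K
    · simpa [hx] using hb x
    · simp [hx, h0 x hx]
  have h2 := h1.trans (eLpNorm_indicator_const_le M 2)
  have h3 : volume K ^ (1 / (2 : ℝ≥0∞).toReal) ≠ ⊤ :=
    ENNReal.rpow_ne_top_of_nonneg (by positivity) hK.measure_lt_top.ne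
  refine (ENNReal.toReal_mono (ENNReal.mul_ne_top (by simp) h3) h2).trans ?_
  rw [ENNReal.toReal_mul]
  simp [abs_of_nonneg hM]

/-- One compact set serves all times in `[-1, 1]`: the image of `[-1, 1] × tsupport f` under the
jointly continuous flow. This turns uniform pointwise bounds into `L²` bounds. -/
theorem exists_compact_pullback_eq_zero {f : 𝓢(ℝ × ℝ, ℂ)} (hf : f ∈ compactlySupportedSchwartz) :
    ∃ K : Set (ℝ × ℝ), IsCompact K ∧ ∀ k : ℝ × ℝ → ℂ, tsupport k ⊆ tsupport f →
      ∀ t ∈ Set.Icc (-1 : ℝ) 1, ∀ x ∉ K, pullback t k x = 0 := by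
  have hc : IsCompact (tsupport f) := hf
  refine ⟨(fun p : ℝ × (ℝ × ℝ) => squeezeFlow p.1 p.2) '' (Set.Icc (-1 : ℝ) 1 ×ˢ tsupport f),
    (isCompact_Icc.prod hc).image continuous_squeezeFlow, fun k hk t ht x hx => ?_⟩
  have : squeezeFlow t x ∉ tsupport k := by
    intro h
    refine hx ⟨(-t, squeezeFlow t x), ⟨?_, hk h⟩, ?_⟩
    · constructor <;> linarith [ht.1, ht.2]
    · simp only [squeezeFlow_squeezeFlow, add_neg_cancel, squeezeFlow_zero]
  rw [pullback, image_eq_zero_of_notMem_tsupport this, mul_zero]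

theorem continuous_pullback (f : 𝓢(ℝ × ℝ, ℂ)) :
    Continuous fun p : ℝ × (ℝ × ℝ) => pullback p.1 f p.2 := by
  unfold pullback
  have h1 := f.continuous.comp continuous_squeezeFlow
  have h2 : Continuous fun p : ℝ × (ℝ × ℝ) => (Real.exp (p.1 * p.2.1 ^ 4 / 2) : ℂ) := by fun_prop
  exact h2.mul h1

theorem hasDerivAt_squeezeGroup_zero {f : 𝓢(ℝ × ℝ, ℂ)} (hf : f ∈ compactlySupportedSchwartz) :
    HasDerivAt (fun t => squeezeGroup t (schwartzToL2 f)) (schwartzToL2 (squeezeGenerator f)) 0 := by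
  obtain ⟨K, hK, hz⟩ := exists_compact_pullback_eq_zero hf
  set f1 := squeezeGenerator f with hf1
  set f2 := squeezeGenerator f1 with hf2
  have hs1 : tsupport f1 ⊆ tsupport f := tsupport_squeezeGenerator_subset f
  have hs2 : tsupport f2 ⊆ tsupport f := (tsupport_squeezeGenerator_subset f1).trans hs1
  have hIK : IsCompact (Set.Icc (-1 : ℝ) 1 ×ˢ K) := isCompact_Icc.prod hK
  obtain ⟨C, hC⟩ := hIK.exists_bound_of_continuousOn (continuous_pullback f2).continuousOn
  have hC' : ∀ t ∈ Set.Icc (-1 : ℝ) 1, ∀ x, ‖pullback t f2 x‖ ≤ max C 0 := by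
    intro t ht x
    by_cases hx : x ∈ K
    · exact (hC (t, x) ⟨ht, hx⟩).trans (le_max_left _ _)
    · rw [hz f2 hs2 t ht x hx, norm_zero]; exact le_max_right _ _
  -- The pointwise Taylor remainder is at most `max C 0 * |t| ^ 2` and lives on `K`; its `L²` norm
  -- picks up the factor `D`, the square root of the volume of `K`.
  set D := (volume K ^ (1 / (2 : ℝ≥0∞).toReal)).toReal
  have key : ∀ t ∈ Set.Icc (-1 : ℝ) 1, ‖squeezeGroup t (schwartzToL2 f) - schwartzToL2 f -
      t • schwartzToL2 f1‖ ≤ max C 0 * |t| ^ 2 * D := by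
    intro t ht
    obtain ⟨k, -, hk, hk'⟩ := exists_squeezeGroup_eq t hf
    have e : squeezeGroup t (schwartzToL2 f) - schwartzToL2 f - t • schwartzToL2 f1 =
        schwartzToL2 (k - f - (t : ℂ) • f1) := by
      rw [hk, map_sub, map_sub, map_smul]; rfl
    refine norm_le_of_ae_eq_of_bound (schwartzToL2_eq_iff.mp e) hK (by positivity) ?_ ?_
    · intro x
      have h1 := norm_sub_sub_le_of_hasDerivAt (F := fun t => pullback t f x)
        (G := fun t => pullback t f1 x) (H := fun t => pullback t f2 x) (C := max C 0) (t := t)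
        (hasDerivAt_pullback f x) (hasDerivAt_pullback f1 x) fun s hs => hC' s ?_ x
      · simpa [pullback_zero, hk'] using h1
      · rcases Set.mem_uIcc.mp hs with h | h <;> constructor <;> linarith [ht.1, ht.2, h.1, h.2]
    · intro x hx
      have a := hz f le_rfl t ht x hx
      have b := hz f le_rfl 0 (by simp) x hx
      have c := hz f1 hs1 0 (by simp) x hx
      rw [pullback_zero] at b c
      simp [hk', a, b, c]
  rw [hasDerivAt_iff_isLittleO_nhds_zero]
  have h2 : (fun t : ℝ => squeezeGroup (0 + t) (schwartzToL2 f) - squeezeGroup 0 (schwartzToL2 f) -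
      t • schwartzToL2 f1) =O[nhds 0] fun t : ℝ => t ^ 2 := by
    refine Asymptotics.IsBigO.of_bound (max C 0 * D) ?_
    filter_upwards [Icc_mem_nhds (show (-1 : ℝ) < 0 by norm_num) one_pos] with t ht
    rw [zero_add, squeezeGroup_zero, one_apply_eq_self, norm_pow, Real.norm_eq_abs]
    linarith [key t ht]
  refine h2.trans_isLittleO ?_
  simpa using Asymptotics.isLittleO_pow_pow (𝕜 := ℝ) (show 1 < 2 by norm_num)

theorem dense_compactlySupportedSchwartz :
    Dense (schwartzToL2 '' (compactlySupportedSchwartz : Set 𝓢(ℝ × ℝ, ℂ))) := by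
  refine (Lp.dense_hasCompactSupport_contDiff (F := ℂ) (μ := (volume : Measure (ℝ × ℝ)))
    (p := 2) (by norm_num)).mono ?_
  rintro ψ ⟨g, hg, hc, hd⟩
  exact ⟨hc.toSchwartzMap hd, hc, (schwartzToL2_eq_iff.mpr hg).symm⟩

theorem isStrongUnitaryGroup_squeezeGroup : IsStrongUnitaryGroup squeezeGroup := by
  refine ⟨squeezeGroup_mem_unitary, squeezeGroup_zero, squeezeGroup_add, fun ψ => ?_⟩
  -- The operators are isometries, so approximating `ψ` by a core vector approximates its whole
  -- orbit uniformly in time; on the core, differentiability at `0` and the group law give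
  -- continuity.
  refine continuous_of_uniform_approx_of_continuous fun u hu => ?_
  obtain ⟨ε, hε, hu⟩ := Metric.mem_uniformity_dist.mp hu
  obtain ⟨_, hd, ⟨f, hf, rfl⟩⟩ := Metric.dense_iff.mp dense_compactlySupportedSchwartz ψ ε hε
  rw [Metric.mem_ball] at hd
  refine ⟨fun t => squeezeGroup t (schwartzToL2 f), ?_, fun t => hu ?_⟩
  · rw [continuous_iff_continuousAt]
    intro s
    obtain ⟨k, hk, hk', -⟩ := exists_squeezeGroup_eq s hf
    have h1 := (hasDerivAt_squeezeGroup_zero hk).continuousAt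
    have h2 : (fun t => squeezeGroup t (schwartzToL2 f)) =
        (fun t => squeezeGroup t (schwartzToL2 k)) ∘ fun t => t - s := by
      funext t
      simp only [Function.comp]
      rw [← hk', ← mul_apply_eq_comp, ← squeezeGroup_add, sub_add_cancel]
    rw [h2]
    refine ContinuousAt.comp ?_ (by fun_prop)
    rwa [sub_self]
  · rw [dist_eq_norm, ← map_sub, norm_squeezeGroup, ← dist_eq_norm]
    rwa [dist_comm]

theorem hamiltonian_isEssentiallySelfAdjoint :
    IsEssentiallySelfAdjoint hamiltonian ∧ IsUnitaryGroupOf hamiltonian.closure squeezeGroup := by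
  refine isStrongUnitaryGroup_squeezeGroup.isEssentiallySelfAdjoint hamiltonian_isFormalAdjoint
    (g := compactlySupportedSchwartz.map
      (schwartzToL2.prod (schwartzToL2 ∘ₗ hamiltonianCLM.toLinearMap))) ?_ ?_ ?_ ?_
  · rintro _ ⟨f, -, rfl⟩
    exact mem_graph_onSchwartz hamiltonianCLM f
  · rintro _ ⟨f, hf, rfl⟩
    have h := hasDerivAt_squeezeGroup_zero hf
    have e : schwartzToL2 (squeezeGenerator f) =
        -Complex.I • schwartzToL2 (hamiltonianCLM f) := by
      rw [squeezeGenerator, smul_apply, map_smul]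
    rw [e] at h
    exact h
  · refine dense_compactlySupportedSchwartz.mono ?_
    rintro _ ⟨f, hf, rfl⟩
    exact ⟨_, ⟨f, hf, rfl⟩, rfl⟩
  · rintro t _ ⟨f, hf, rfl⟩
    obtain ⟨k, hk, hk', -⟩ := exists_squeezeGroup_eq t hf
    refine ⟨schwartzToL2 (hamiltonianCLM k), k, hk, ?_⟩
    exact Prod.ext hk'.symm rfl

end Core

/-! ### Hermite functions and their Gaussian integrals -/

section Hermite

open Polynomial

/-- The physicists' Hermite polynomials. -/
noncomputable def physHermite : ℕ → ℝ[X]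
  | 0 => 1
  | n + 1 => 2 * X * physHermite n - derivative (physHermite n)

theorem derivative_physHermite_succ (n : ℕ) :
    derivative (physHermite (n + 1)) = C (2 * (n + 1) : ℝ) * physHermite n := by
  induction n with
  | zero => simpa [physHermite] using (map_ofNat (C : ℝ →+* ℝ[X]) 2).symm
  | succ n ih =>
    rw [physHermite, derivative_sub, derivative_mul, derivative_mul, ih, derivative_mul,
      derivative_C]
    conv_rhs => rw [physHermite]
    simp only [derivative_X, derivative_ofNat, map_mul, map_add, map_ofNat, map_one, map_natCast]
    push_cast
    conv_lhs => rw [physHermite]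
    ring

theorem integrable_polynomial_mul_gaussian (p : ℝ[X]) {c : ℝ} (hc : 0 < c) :
    Integrable fun y => p.eval y * Real.exp (-c * y ^ 2) := by
  induction p using Polynomial.induction_on' with
  | add p q hp hq => simpa [add_mul] using! hp.add hq
  | monomial n a =>
    have h := integrable_rpow_mul_exp_neg_mul_sq hc (s := n) (by
      have : (0 : ℝ) ≤ n := n.cast_nonneg
      linarith)
    simpa [mul_assoc] using h.const_mul a

/-- Integration by parts gives `∫ H' e^{-cy²} = c ∫ 2y H e^{-cy²}` for `H = H_{n+1}`. Hence the
recurrence `H_{n+2} = 2yH - H'` integrates to `(1/c - 1) ∫ H'`, and `H' = 2(n+1) H_n`. -/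
theorem integral_physHermite_add_two (n : ℕ) {c : ℝ} (hc : 0 < c) :
    ∫ y, (physHermite (n + 2)).eval y * Real.exp (-c * y ^ 2) =
      -(1 - 1 / c) * (2 * (n + 1)) * ∫ y, (physHermite n).eval y * Real.exp (-c * y ^ 2) := by
  set H := physHermite (n + 1) with hH
  have hd : ∀ y, HasDerivAt (fun y => H.eval y * Real.exp (-c * y ^ 2))
      ((derivative H).eval y * Real.exp (-c * y ^ 2) -
        c * ((2 * X * H).eval y * Real.exp (-c * y ^ 2))) y := by
    intro y
    have h1 : HasDerivAt (fun y : ℝ => -c * y ^ 2) (-c * (2 * y)) y := by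
      simpa using (hasDerivAt_pow 2 y).const_mul (-c)
    refine ((H.hasDerivAt y).mul h1.exp).congr_deriv ?_
    simp only [eval_mul, eval_X, eval_ofNat]
    ring
  have i1 := integrable_polynomial_mul_gaussian (derivative H) hc
  have i2 := integrable_polynomial_mul_gaussian (2 * X * H) hc
  have h0 := integral_eq_zero_of_hasDerivAt_of_integrable hd (i1.sub (i2.const_mul c))
    (integrable_polynomial_mul_gaussian H hc)
  rw [integral_sub i1 (i2.const_mul c), integral_const_mul] at h0
  have e1 : ∀ y, (physHermite (n + 2)).eval y * Real.exp (-c * y ^ 2) =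
      (2 * X * H).eval y * Real.exp (-c * y ^ 2) -
        (derivative H).eval y * Real.exp (-c * y ^ 2) := by
    intro y; rw [physHermite, eval_sub, sub_mul]
  have e2 : ∀ y, (derivative H).eval y * Real.exp (-c * y ^ 2) =
      (2 * (n + 1)) * ((physHermite n).eval y * Real.exp (-c * y ^ 2)) := by
    intro y; rw [hH, derivative_physHermite_succ, eval_mul, eval_C, mul_assoc]
  simp only [e1]
  rw [integral_sub i2 i1]
  simp only [e2, integral_const_mul] at h0 ⊢
  generalize (∫ y, (physHermite n).eval y * Real.exp (-c * y ^ 2)) = I at h0 ⊢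
  generalize (∫ y, (2 * X * H).eval y * Real.exp (-c * y ^ 2)) = J at h0 ⊢
  field_simp
  linear_combination (-1) * h0

/-- The product `1 · 3 ⋯ (2k - 1)`. -/
noncomputable def oddProd (k : ℕ) : ℝ := ∏ j ∈ Finset.range k, (2 * (j : ℝ) + 1)

theorem integral_physHermite_even (k : ℕ) {c : ℝ} (hc : 0 < c) :
    ∫ y, (physHermite (2 * k)).eval y * Real.exp (-c * y ^ 2) =
      (-2) ^ k * oddProd k * (1 - 1 / c) ^ k * Real.sqrt (Real.pi / c) := by
  induction k with
  | zero => simpa [physHermite, oddProd] using integral_gaussian c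
  | succ k ih =>
    rw [show 2 * (k + 1) = 2 * k + 2 by ring, integral_physHermite_add_two _ hc, ih, oddProd,
      oddProd, Finset.prod_range_succ]
    push_cast
    ring

/-- The ratio is `(2k-1)!! / (2k)!!`, which decays only like `k^{-1/2}`; multiplied by `2k` it
equals `1` at `k = 1` and grows by the factor `(2k+1)/(2k)` at each step. -/
theorem one_le_oddProd_sq_div {k : ℕ} (hk : 1 ≤ k) :
    1 ≤ 2 * (k : ℝ) * (oddProd k ^ 2 / (2 * k).factorial) := by
  induction k, hk using Nat.le_induction with
  | base => simp [oddProd]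
  | succ k hk ih =>
    have h1 : oddProd (k + 1) = oddProd k * (2 * k + 1) := by
      rw [oddProd, Finset.prod_range_succ]; rfl
    have h2 : ((2 * (k + 1)).factorial : ℝ) = (2 * k + 2) * ((2 * k + 1) * (2 * k).factorial) := by
      rw [show 2 * (k + 1) = 2 * k + 1 + 1 by ring, Nat.factorial_succ, Nat.factorial_succ]
      push_cast; ring
    have h3 : (0 : ℝ) < (2 * k).factorial := by positivity
    have h4 : 0 ≤ oddProd k ^ 2 / (2 * k).factorial := by positivity
    rw [h1, h2]
    push_cast
    have e : 2 * ((k : ℝ) + 1) * ((oddProd k * (2 * k + 1)) ^ 2 /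
        ((2 * k + 2) * ((2 * k + 1) * (2 * k).factorial))) =
        (2 * k + 1) * (oddProd k ^ 2 / (2 * k).factorial) := by
      field_simp
    rw [e]
    linarith

theorem opAdag_apply (j : Fin 2) (f : 𝓢(ℝ × ℝ, ℂ)) (x : ℝ × ℝ) :
    opAdag j f x = (Real.sqrt 2 : ℂ)⁻¹ * ((coord j x : ℂ) * f x - lineDeriv ℝ f x (dir j)) := by
  rw [opAdag, smul_apply, smul_apply, sub_apply, sub_apply, smul_apply, smul_apply, opX_apply,
    opP_apply]
  have hI := Complex.I_sq
  simp only [smul_eq_mul]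
  linear_combination (Real.sqrt 2 : ℂ)⁻¹ * lineDeriv ℝ f x (dir j) * hI

/-- On `p(y) e^{-y²/2}` the operator `√2 a†` acts by `p ↦ 2yp - p'`, the recurrence that defines
`physHermite`. -/
theorem opAdag_one_pow_vacuum (n : ℕ) (x : ℝ × ℝ) :
    (opAdag 1 ^ n) vacuum x = (Real.sqrt Real.pi : ℂ)⁻¹ * ((Real.sqrt 2 : ℂ)⁻¹) ^ n *
      (Real.exp (-x.1 ^ 2 / 2) * ((physHermite n).eval x.2 * Real.exp (-x.2 ^ 2 / 2)) : ℝ) := by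
  induction n generalizing x with
  | zero =>
    have : -(x.1 ^ 2 + x.2 ^ 2) / 2 = -x.1 ^ 2 / 2 + -x.2 ^ 2 / 2 := by ring
    rw [pow_zero, one_apply_eq_self, vacuum_apply, this, Real.exp_add]
    simp [physHermite]
  | succ n ih =>
    rw [pow_succ', mul_apply_eq_comp, opAdag_apply]
    have hfun : ⇑((opAdag 1 ^ n) vacuum) = fun x : ℝ × ℝ => (Real.sqrt Real.pi : ℂ)⁻¹ *
        ((Real.sqrt 2 : ℂ)⁻¹) ^ n * (Real.exp (-x.1 ^ 2 / 2) * ((physHermite n).eval x.2 *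
          Real.exp (-x.2 ^ 2 / 2)) : ℝ) := funext ih
    have hd : HasLineDerivAt ℝ ((opAdag 1 ^ n) vacuum) ((Real.sqrt Real.pi : ℂ)⁻¹ *
        ((Real.sqrt 2 : ℂ)⁻¹) ^ n * (Real.exp (-x.1 ^ 2 / 2) *
          ((derivative (physHermite n)).eval x.2 * Real.exp (-x.2 ^ 2 / 2) -
            x.2 * (physHermite n).eval x.2 * Real.exp (-x.2 ^ 2 / 2)) : ℝ)) x (dir 1) := by
      rw [hfun]
      unfold HasLineDerivAt
      refine HasDerivAt.const_mul _ (HasDerivAt.ofReal_comp ?_)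
      have e : ∀ s : ℝ, x + s • dir 1 = (x.1, x.2 + s) := by
        intro s; ext <;> simp [dir]
      simp only [e]
      refine HasDerivAt.const_mul _ ?_
      have h2 : HasDerivAt (fun y : ℝ => -y ^ 2 / 2) (-x.2) x.2 := by
        refine ((hasDerivAt_pow 2 x.2).neg.div_const 2).congr_deriv ?_
        simp only [Nat.cast_ofNat, Nat.add_one_sub_one, pow_one]
        ring
      have h1 : HasDerivAt (fun y : ℝ => (physHermite n).eval y * Real.exp (-y ^ 2 / 2))
          ((derivative (physHermite n)).eval x.2 * Real.exp (-x.2 ^ 2 / 2) -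
            x.2 * (physHermite n).eval x.2 * Real.exp (-x.2 ^ 2 / 2)) (x.2 + 0) := by
        rw [add_zero]
        refine (((physHermite n).hasDerivAt x.2).mul h2.exp).congr_deriv ?_
        ring
      exact h1.comp_const_add x.2 0
    rw [hd.lineDeriv, ih, physHermite]
    simp only [coord, Matrix.cons_val_one, Matrix.cons_val_fin_one, ContinuousLinearMap.coe_snd',
      eval_sub, eval_mul, eval_X, eval_ofNat]
    push_cast
    ring

end Hermite

/-! ### Lower bounds for the overlap integrals -/

section Divergence

/-- The Gaussian rate `(1 + e^{2r}) / 2`, `r = t a⁴`, of the product of the vacuum with the squeezed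
vacuum. -/
noncomputable def rate (t a : ℝ) : ℝ := (1 + Real.exp (t * a ^ 4) ^ 2) / 2

/-- `∫ e^{-a²} tanh(t a⁴)^k / √(cosh (t a⁴)) da`. -/
noncomputable def overlapIntegral (t : ℝ) (k : ℕ) : ℝ :=
  ∫ a, Real.exp (-a ^ 2) * (Real.exp (t * a ^ 4 / 2) / Real.sqrt (rate t a)) *
    (1 - 1 / rate t a) ^ k

theorem rate_pos (t a : ℝ) : 0 < rate t a := by unfold rate; positivity

theorem continuous_rate (t : ℝ) : Continuous (rate t) := by unfold rate; fun_prop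

theorem one_le_rate {t : ℝ} (ht : 0 < t) (a : ℝ) : 1 ≤ rate t a := by
  have : 1 ≤ Real.exp (t * a ^ 4) := Real.one_le_exp (by positivity)
  unfold rate; nlinarith

theorem one_sub_rate_mem {t : ℝ} (ht : 0 < t) (a : ℝ) :
    0 ≤ 1 - 1 / rate t a ∧ 1 - 1 / rate t a ≤ 1 := by
  have h1 := rate_pos t a
  have h2 : 1 / rate t a ≤ 1 := (div_le_one h1).mpr (one_le_rate ht a)
  have h3 : 0 ≤ 1 / rate t a := by positivity
  constructor <;> linarith

/-- With `r = t a⁴`, `rate t a = e^r cosh r`, so the quotient is `1/√(cosh r)`. The crude bound `2`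
is enough to dominate the integrand by a Gaussian. -/
theorem exp_div_sqrt_rate_le {t : ℝ} (ht : 0 < t) (a : ℝ) :
    Real.exp (t * a ^ 4 / 2) / Real.sqrt (rate t a) ≤ 2 := by
  have h1 : 0 < Real.sqrt (rate t a) := Real.sqrt_pos.mpr (rate_pos t a)
  rw [div_le_iff₀ h1]
  have h2 : 1 ≤ Real.exp (t * a ^ 4 / 2) := Real.one_le_exp (by positivity)
  have h3 : Real.exp (t * a ^ 4) = Real.exp (t * a ^ 4 / 2) ^ 2 := by
    rw [← Real.exp_nat_mul]; congr 1; push_cast; ring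
  have h4 : (Real.exp (t * a ^ 4 / 2) / 2) ≤ Real.sqrt (rate t a) := by
    refine Real.le_sqrt_of_sq_le ?_
    rw [rate, h3]
    have h5 : 1 ≤ Real.exp (t * a ^ 4 / 2) ^ 2 := one_le_pow₀ h2
    nlinarith
  linarith

theorem integrable_overlap {t : ℝ} (ht : 0 < t) (k : ℕ) :
    Integrable fun a => Real.exp (-a ^ 2) * (Real.exp (t * a ^ 4 / 2) / Real.sqrt (rate t a)) *
      (1 - 1 / rate t a) ^ k := by
  have hg : Integrable fun a : ℝ => 2 * Real.exp (-1 * a ^ 2) :=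
    (integrable_exp_neg_mul_sq one_pos).const_mul 2
  have hr := continuous_rate t
  have h0 : ∀ a, Real.sqrt (rate t a) ≠ 0 := fun a => (Real.sqrt_pos.mpr (rate_pos t a)).ne'
  have h0' : ∀ a, rate t a ≠ 0 := fun a => (rate_pos t a).ne'
  refine hg.mono' (Continuous.aestronglyMeasurable ?_) (Filter.Eventually.of_forall fun a => ?_)
  · refine Continuous.mul (Continuous.mul (by fun_prop)
      (Continuous.div (by fun_prop) (hr.sqrt) h0)) ?_
    exact (continuous_const.sub (continuous_const.div hr h0')).pow k
  · obtain ⟨h1, h2⟩ := one_sub_rate_mem ht a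
    have h3 := exp_div_sqrt_rate_le ht a
    have h4 : (1 - 1 / rate t a) ^ k ≤ 1 := pow_le_one₀ h1 h2
    rw [Real.norm_of_nonneg (by positivity)]
    calc _ ≤ Real.exp (-a ^ 2) * 2 * 1 := by gcongr
      _ = _ := by rw [neg_one_mul]; ring

theorem overlapIntegral_nonneg {t : ℝ} (ht : 0 < t) (k : ℕ) : 0 ≤ overlapIntegral t k := by
  refine integral_nonneg fun a => ?_
  have := (one_sub_rate_mem ht a).1
  positivity

theorem overlapIntegral_antitone {t : ℝ} (ht : 0 < t) : Antitone (overlapIntegral t) := by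
  intro k l hkl
  refine integral_mono (integrable_overlap ht l) (integrable_overlap ht k) fun a => ?_
  obtain ⟨h1, h2⟩ := one_sub_rate_mem ht a
  have h3 := pow_le_pow_of_le_one h1 h2 hkl
  dsimp only
  gcongr

/-- The nonnegative integrand is kept only on `[X, X + 1]`. There `hN` makes the `tanh^N` factor at
least `1/2`, and the other factors are at least `e^{-a²}` and `e^{-t a⁴/2}`, smallest at the right
end. -/
theorem le_overlapIntegral {t : ℝ} (ht : 0 < t) {X : ℝ} (hX : 0 ≤ X) {N : ℕ}
    (hN : 4 * (N : ℝ) ≤ Real.exp (t * X ^ 4) ^ 2) :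
    Real.exp (-(X + 1) ^ 2 - t * (X + 1) ^ 4 / 2) / 2 ≤ overlapIntegral t N := by
  set m := Real.exp (-(X + 1) ^ 2 - t * (X + 1) ^ 4 / 2) / 2 with hm
  have hint := integrable_overlap ht N
  have h1 : ∫ _ in Set.Icc X (X + 1), m = m := by simp
  rw [← h1, overlapIntegral]
  refine le_trans (setIntegral_mono_on (by simp) hint.integrableOn measurableSet_Icc ?_)
    (setIntegral_le_integral hint (Filter.Eventually.of_forall fun a => ?_))
  · intro a ha
    have ha0 : 0 ≤ a := hX.trans ha.1
    have hE1 : 1 ≤ Real.exp (t * a ^ 4) := Real.one_le_exp (by positivity)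
    have hEX : Real.exp (t * X ^ 4) ≤ Real.exp (t * a ^ 4) := by
      have := ha.1; gcongr
    have hsq : Real.sqrt (rate t a) ≤ Real.exp (t * a ^ 4) := by
      refine Real.sqrt_le_iff.mpr ⟨by positivity, ?_⟩
      unfold rate; nlinarith
    -- Bernoulli: the power is at least `1 - N / rate`, and `rate ≥ e^{2ta⁴}/2 ≥ 2N`.
    have hpow : 1 / 2 ≤ (1 - 1 / rate t a) ^ N := by
      have h2 : 1 / rate t a ≤ 1 := (div_le_one (rate_pos t a)).mpr (one_le_rate ht a)
      have h3 := one_add_mul_le_pow (show -2 ≤ -(1 / rate t a) by linarith) N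
      have h4 : (N : ℝ) * (1 / rate t a) ≤ 1 / 2 := by
        rw [mul_one_div, div_le_iff₀ (rate_pos t a)]
        have : Real.exp (t * X ^ 4) ^ 2 ≤ Real.exp (t * a ^ 4) ^ 2 := by gcongr
        unfold rate; linarith
      rw [← sub_eq_add_neg] at h3
      linarith
    have hw : Real.exp (-(t * a ^ 4 / 2)) ≤
        Real.exp (t * a ^ 4 / 2) / Real.sqrt (rate t a) := by
      rw [le_div_iff₀ (Real.sqrt_pos.mpr (rate_pos t a))]
      calc _ ≤ Real.exp (-(t * a ^ 4 / 2)) * Real.exp (t * a ^ 4) := by gcongr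
        _ = _ := by rw [← Real.exp_add]; congr 1; ring
    have hexp : Real.exp (-(X + 1) ^ 2 - t * (X + 1) ^ 4 / 2) ≤
        Real.exp (-a ^ 2) * Real.exp (-(t * a ^ 4 / 2)) := by
      rw [← Real.exp_add]
      refine Real.exp_le_exp.mpr ?_
      have h5 : a ^ 2 ≤ (X + 1) ^ 2 := by have := ha.2; gcongr
      have h6 : t * a ^ 4 ≤ t * (X + 1) ^ 4 := by have := ha.2; gcongr
      linarith
    calc m ≤ Real.exp (-a ^ 2) * Real.exp (-(t * a ^ 4 / 2)) * (1 / 2) := by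
          rw [hm, mul_one_div]; gcongr
      _ ≤ _ := by gcongr
  · have := (one_sub_rate_mem ht a).1
    simp only [Pi.zero_apply]
    positivity

theorem exists_le_mul_overlapIntegral_sq {t : ℝ} (ht : 0 < t) (M : ℝ) :
    ∃ N : ℕ, M ≤ N * overlapIntegral t N ^ 2 := by
  -- The three terms ensure, in order, that `(X+1)⁴` is at most `5/4 X⁴`, that `M ≤ X/8`, and that
  -- `t X ≥ 20`.
  set X := 20 + 8 * |M| + 20 / t with hXdef
  have hM0 := abs_nonneg M
  have hMle := le_abs_self M
  have ht' : 0 < 20 / t := by positivity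
  have hX20 : 20 ≤ X := by linarith
  have hX0 : 0 ≤ X := by linarith
  have htX : 20 ≤ t * X := by
    have h1 : 20 / t ≤ X := by linarith
    rw [div_le_iff₀ ht] at h1; linarith
  have htX2 : 20 ≤ t * X ^ 2 := by nlinarith
  have htX4 : 20 * X ^ 2 ≤ t * X ^ 4 := by
    have : t * X ^ 4 = t * X ^ 2 * X ^ 2 := by ring
    rw [this]; gcongr
  set R := t * X ^ 4 with hR
  have hR1 : 8000 ≤ R := by nlinarith
  -- The exponent `3/2` lies strictly between two constraints: below `2`, so that `4N ≤ e^{2R}`, and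
  -- above `5/4`, so that `N` outweighs the loss `e^{-t(X+1)⁴} ≥ e^{-5R/4}`.
  set N := ⌊Real.exp (3 / 2 * R)⌋₊ with hNdef
  have hNle : (N : ℝ) ≤ Real.exp (3 / 2 * R) := Nat.floor_le (Real.exp_pos _).le
  have hNge : Real.exp (3 / 2 * R) / 2 ≤ N := by
    have h1 := Nat.lt_floor_add_one (Real.exp (3 / 2 * R))
    have h2 := Real.add_one_le_exp (3 / 2 * R)
    linarith
  have hN : 4 * (N : ℝ) ≤ Real.exp R ^ 2 := by
    have h1 : Real.exp R ^ 2 = Real.exp (3 / 2 * R) * Real.exp (R / 2) := by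
      rw [← Real.exp_nat_mul, ← Real.exp_add]; congr 1; push_cast; ring
    have h2 := Real.add_one_le_exp (R / 2)
    rw [h1]
    nlinarith [Real.exp_pos (3 / 2 * R)]
  have h1 := le_overlapIntegral ht hX0 hN
  refine ⟨N, ?_⟩
  have hX4 : t * (X + 1) ^ 4 ≤ 5 / 4 * R := by
    have h2 : (X + 1) ^ 2 ≤ 111 / 100 * X ^ 2 := by nlinarith
    have h3 : (X + 1) ^ 4 ≤ 5 / 4 * X ^ 4 := by
      calc (X + 1) ^ 4 = ((X + 1) ^ 2) ^ 2 := by ring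
        _ ≤ (111 / 100 * X ^ 2) ^ 2 := by gcongr
        _ = (111 / 100) ^ 2 * X ^ 4 := by ring
        _ ≤ 5 / 4 * X ^ 4 := by gcongr; norm_num
    rw [hR]; nlinarith
  -- The right side is at least `R/4 - 2(X+1)²`, and `R ≥ 20 X²` leaves more than `2X²`.
  have hexp : X ≤ 3 / 2 * R + 2 * (-(X + 1) ^ 2 - t * (X + 1) ^ 4 / 2) := by
    nlinarith
  calc M ≤ X / 8 := by linarith
    _ ≤ Real.exp X / 8 := by
        have := Real.add_one_le_exp X; linarith
    _ ≤ Real.exp (3 / 2 * R + 2 * (-(X + 1) ^ 2 - t * (X + 1) ^ 4 / 2)) / 8 := by gcongr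
    _ = Real.exp (3 / 2 * R) / 2 *
        (Real.exp (-(X + 1) ^ 2 - t * (X + 1) ^ 4 / 2) / 2) ^ 2 := by
        rw [Real.exp_add, div_pow, ← Real.exp_nat_mul]; push_cast; ring
    _ ≤ N * overlapIntegral t N ^ 2 := by gcongr

end Divergence

/-! ### Fock amplitudes of the evolved vacuum and divergence of the energy -/

section Energy

theorem fock_zero_zero : fock 0 0 = schwartzToL2 vacuum := by
  simp [fock]

theorem coeFn_fock_zero (n : ℕ) : fock 0 n =ᵐ[volume] fun x : ℝ × ℝ =>
    (((Real.sqrt n.factorial)⁻¹ * (Real.sqrt Real.pi)⁻¹ * ((Real.sqrt 2)⁻¹) ^ n *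
      (Real.exp (-x.1 ^ 2 / 2) * ((physHermite n).eval x.2 * Real.exp (-x.2 ^ 2 / 2))) : ℝ) : ℂ) := by
  refine (coeFn_schwartzToL2 _).trans (Filter.Eventually.of_forall fun x => ?_)
  dsimp only
  rw [smul_apply, pow_zero, one_mul, opAdag_one_pow_vacuum, smul_eq_mul]
  push_cast
  simp only [Nat.factorial_zero, Nat.cast_one, one_mul]
  ring

theorem coeFn_squeezeGroup_fock (t : ℝ) : squeezeGroup t (fock 0 0) =ᵐ[volume] fun x : ℝ × ℝ =>
    ((Real.exp (t * x.1 ^ 4 / 2) * ((Real.sqrt Real.pi)⁻¹ *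
      Real.exp (-(x.1 ^ 2 + (Real.exp (t * x.1 ^ 4) * x.2) ^ 2) / 2)) : ℝ) : ℂ) := by
  rw [fock_zero_zero]
  refine ((coeFn_squeezeGroup t _).trans (pullback_ae_congr t (coeFn_schwartzToL2 vacuum))).trans
    (Filter.Eventually.of_forall fun x => ?_)
  simp only [pullback, vacuum_apply, squeezeFlow]
  push_cast
  rfl

/-- Fubini, integrating over mode 1 first: for fixed `a` this is the Hermite–Gaussian integral with
`c = rate t a`, so `1 - 1/c = tanh(t a⁴)`. -/
theorem integral_mul_eq_overlapIntegral (t : ℝ) (k : ℕ) {F : ℝ × ℝ → ℝ} {K : ℝ}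
    (hF : Integrable F) (hFK : ∀ a y, F (a, y) = K * (Real.exp (-a ^ 2) * Real.exp (t * a ^ 4 / 2)) *
      ((physHermite (2 * k)).eval y * Real.exp (-rate t a * y ^ 2))) :
    ∫ x, F x = K * ((-2) ^ k * oddProd k * Real.sqrt Real.pi) * overlapIntegral t k := by
  rw [Measure.volume_eq_prod] at hF ⊢
  rw [integral_prod _ hF, overlapIntegral, ← integral_const_mul]
  refine integral_congr_ae (Filter.Eventually.of_forall fun a => ?_)
  simp only [hFK]
  rw [integral_const_mul, integral_physHermite_even _ (rate_pos t a), Real.sqrt_div Real.pi_pos.le]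
  ring

theorem inner_fock_squeezeGroup (t : ℝ) (k : ℕ) :
    inner ℂ (fock 0 (2 * k)) (squeezeGroup t (fock 0 0)) =
      (((-1) ^ k * (oddProd k / Real.sqrt (2 * k).factorial) * (Real.sqrt Real.pi)⁻¹ *
        overlapIntegral t k : ℝ) : ℂ) := by
  set F : ℝ × ℝ → ℝ := fun x => ((Real.sqrt (2 * k).factorial)⁻¹ * (Real.sqrt Real.pi)⁻¹ *
      ((Real.sqrt 2)⁻¹) ^ (2 * k) * (Real.exp (-x.1 ^ 2 / 2) *
        ((physHermite (2 * k)).eval x.2 * Real.exp (-x.2 ^ 2 / 2)))) *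
      (Real.exp (t * x.1 ^ 4 / 2) * ((Real.sqrt Real.pi)⁻¹ *
        Real.exp (-(x.1 ^ 2 + (Real.exp (t * x.1 ^ 4) * x.2) ^ 2) / 2))) with hF
  have hae : (fun x => inner ℂ (fock 0 (2 * k) x) (squeezeGroup t (fock 0 0) x)) =ᵐ[volume]
      fun x => (F x : ℂ) := by
    filter_upwards [coeFn_fock_zero (2 * k), coeFn_squeezeGroup_fock t] with x h1 h2
    rw [h1, h2, RCLike.inner_apply, Complex.conj_ofReal, ← Complex.ofReal_mul, mul_comm]
  -- Integrability comes for free from the inner product of two `L²` functions, with no estimate on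
  -- `F`.
  have hFint : Integrable F := by
    have h1 := ((L2.integrable_inner (𝕜 := ℂ) (fock 0 (2 * k))
      (squeezeGroup t (fock 0 0))).congr hae).re
    simpa using h1
  rw [L2.inner_def, integral_congr_ae hae, integral_complex_ofReal]
  congr 1
  have h2 : ((Real.sqrt 2)⁻¹) ^ (2 * k) = (2 ^ k)⁻¹ := by
    rw [pow_mul, inv_pow, Real.sq_sqrt (by norm_num), inv_pow]
  rw [integral_mul_eq_overlapIntegral t k (K := (Real.sqrt (2 * k).factorial)⁻¹ *
    (Real.sqrt Real.pi)⁻¹ * (2 ^ k)⁻¹ * (Real.sqrt Real.pi)⁻¹) hFint]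
  · have hpi : Real.sqrt Real.pi ≠ 0 := (Real.sqrt_pos.mpr Real.pi_pos).ne'
    have h3 : (-2 : ℝ) ^ k = (-1) ^ k * 2 ^ k := by rw [← mul_pow]; norm_num
    rw [h3]
    field_simp
  · intro a y
    have e1 : Real.exp (-a ^ 2) = Real.exp (-a ^ 2 / 2) * Real.exp (-a ^ 2 / 2) := by
      rw [← Real.exp_add]; ring_nf
    have e2 : Real.exp (-(a ^ 2 + (Real.exp (t * a ^ 4) * y) ^ 2) / 2) =
        Real.exp (-a ^ 2 / 2) * Real.exp (-(Real.exp (t * a ^ 4) * y) ^ 2 / 2) := by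
      rw [← Real.exp_add]; ring_nf
    have e3 : Real.exp (-rate t a * y ^ 2) =
        Real.exp (-y ^ 2 / 2) * Real.exp (-(Real.exp (t * a ^ 4) * y) ^ 2 / 2) := by
      rw [← Real.exp_add, rate]; congr 1; ring
    simp only [hF, h2]
    rw [e1, e2, e3]
    ring

/-- The photon number `2k` compensates the decay of the squared normalisation factor
(`one_le_oddProd_sq_div`), leaving only the overlap integral. -/
theorem le_photonProb {t : ℝ} {k : ℕ} (hk : 1 ≤ k) :
    ENNReal.ofReal (overlapIntegral t k ^ 2 / Real.pi) ≤
      ((2 * k : ℕ) : ℝ≥0∞) * photonProb (squeezeGroup t (fock 0 0)) 0 (2 * k) := by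
  rw [photonProb, inner_fock_squeezeGroup, ← ofReal_norm, Complex.norm_real, Real.norm_eq_abs,
    ← ENNReal.ofReal_pow (abs_nonneg _), sq_abs, ← ENNReal.ofReal_natCast,
    ← ENNReal.ofReal_mul (Nat.cast_nonneg _)]
  refine ENNReal.ofReal_le_ofReal ?_
  have h1 := one_le_oddProd_sq_div hk
  have h2 : ((-1 : ℝ) ^ k) ^ 2 = 1 := by rw [← pow_mul, mul_comm, pow_mul]; simp
  rw [mul_pow, mul_pow, mul_pow, h2, div_pow, Real.sq_sqrt (Nat.cast_nonneg _), inv_pow,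
    Real.sq_sqrt Real.pi_pos.le]
  have h3 : 0 ≤ overlapIntegral t k ^ 2 / Real.pi := by positivity
  calc overlapIntegral t k ^ 2 / Real.pi
      ≤ 2 * (k : ℝ) * (oddProd k ^ 2 / (2 * k).factorial) *
        (overlapIntegral t k ^ 2 / Real.pi) := le_mul_of_one_le_left h3 h1
    _ = _ := by push_cast; ring

theorem energyModeOne_squeezeGroup {t : ℝ} (ht : 0 < t) :
    energyModeOne (squeezeGroup t (fock 0 0)) = ⊤ := by
  set ψ := squeezeGroup t (fock 0 0) with hψ
  -- All terms are nonnegative, so only `m = 0` and even `n` are kept.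
  have h1 : ∑' k : ℕ, ((2 * k : ℕ) : ℝ≥0∞) * photonProb ψ 0 (2 * k) ≤ energyModeOne ψ :=
    (ENNReal.tsum_comp_le_tsum_of_injective (mul_right_injective₀ (two_ne_zero' ℕ))
      fun n : ℕ => (n : ℝ≥0∞) * photonProb ψ 0 n).trans
      (ENNReal.le_tsum (f := fun m : ℕ => ∑' n : ℕ, (n : ℝ≥0∞) * photonProb ψ m n) 0)
  refine top_le_iff.mp (le_trans ?_ h1)
  refine ENNReal.le_of_forall_nnreal_lt fun r _ => ?_
  obtain ⟨N, hN⟩ := exists_le_mul_overlapIntegral_sq ht (r * Real.pi)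
  calc (r : ℝ≥0∞) ≤ ENNReal.ofReal (N * (overlapIntegral t N ^ 2 / Real.pi)) := by
        rw [← ENNReal.ofReal_coe_nnreal]
        refine ENNReal.ofReal_le_ofReal ?_
        rw [← mul_div_assoc, le_div_iff₀ Real.pi_pos]
        exact hN
    -- `N` equal copies of the smallest term; monotonicity in `k` then compares each copy with the
    -- true term. The range starts at `1` because the lower bound on the weighted probability needs
    -- `k ≥ 1`.
    _ = ∑ k ∈ Finset.Icc 1 N, ENNReal.ofReal (overlapIntegral t N ^ 2 / Real.pi) := by
        rw [Finset.sum_const, Nat.card_Icc, Nat.add_sub_cancel, nsmul_eq_mul,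
          ENNReal.ofReal_mul (Nat.cast_nonneg _), ENNReal.ofReal_natCast]
    _ ≤ ∑ k ∈ Finset.Icc 1 N, ((2 * k : ℕ) : ℝ≥0∞) * photonProb ψ 0 (2 * k) := by
        refine Finset.sum_le_sum fun k hk => ?_
        obtain ⟨hk1, hk2⟩ := Finset.mem_Icc.mp hk
        refine (ENNReal.ofReal_le_ofReal ?_).trans (le_photonProb hk1)
        have h2 := overlapIntegral_antitone ht hk2
        have h3 := overlapIntegral_nonneg ht N
        gcongr
    _ ≤ _ := ENNReal.sum_le_tsum _

theorem energyModeOne_le_energy (ψ : TwoModeSpace) : energyModeOne ψ ≤ energy ψ := by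
  refine ENNReal.tsum_le_tsum fun m => ENNReal.tsum_le_tsum fun n => ?_
  gcongr
  omega

end Energy

theorem mainTheorem11 :
    IsEssentiallySelfAdjoint hamiltonian ∧
    (∃! U : ℝ → TwoModeSpace →L[ℂ] TwoModeSpace, IsUnitaryGroupOf hamiltonian.closure U) ∧
    ∀ U : ℝ → TwoModeSpace →L[ℂ] TwoModeSpace, IsUnitaryGroupOf hamiltonian.closure U →
      ∀ t : ℝ, 0 < t →
        energyModeOne (U t (fock 0 0)) = ⊤ ∧ energy (U t (fock 0 0)) = ⊤ := by
  obtain ⟨hH, hU⟩ := hamiltonian_isEssentiallySelfAdjoint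
  have hdense : Dense (hamiltonian.closure.domain : Set TwoModeSpace) :=
    hH.1.mono hamiltonian.le_closure.1
  refine ⟨hH, ⟨squeezeGroup, hU, fun V hV => hV.unique hdense hU⟩, fun V hV t ht => ?_⟩
  rw [hV.unique hdense hU]
  have h := energyModeOne_squeezeGroup ht
  exact ⟨h, top_le_iff.mp (h ▸ energyModeOne_le_energy _)⟩
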